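/- Let $r>0$ and let $X=\mathbb{R}\times L^2([-r,0],\mathbb{R})$ with norm $|x|=\big(|x_0|^2+\int_{-r}^0|x_1(\xi)|^2\,d\xi\big)^{1/2}$. Let $a_0\le 0$, $a_1\in L^2([-r,0],\mathbb{R})$, $b_0\ge 0$, $b_1\in L^2([-r,0],\mathbb{R}_+)$, $\sigma\in\mathbb{R}$, and let $U\subseteq\mathbb{R}_+$ be a nonempty compact interval. On $X$ consider the operator $$A(x_0,x_1)=\Big(a_0x_0+x_1(0),\;a_1x_0-\tfrac{dx_1}{d\xi}\Big),\qquad D(A)=\{x\in X:\ x_1\in W^{1,2}([-r,0]),\ x_1(-r)=0\},$$ and put $Bu=(b_0u,b_1u)$ for $u\in U$ and $Gw=(\sigma w,0)$ for $w\in\mathbb{R}$. Let $T>0$, $K>0$, $m\ge 0$, let $\varphi_0:\mathbb{R}\to\mathbb{R}$ and $h_0:\mathbb{R}_+\to\mathbb{R}_+$ be measurable with $|\varphi_0(y)|\le K(1+|y|)^m$ for all $y\in\mathbb{R}$ and $|h_0(u)|\le K$ for all $u\in U$, and put $\varphi(x_0,x_1)=\varphi_0(x_0)$, $h=-h_0$.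 Let $W_0$ be a real Brownian motion on a probability space $(\Omega,\mathcal{F},\mathbb{P})$, let $\mathbb{F}$ be the completion of the filtration generated by $W_0$, and let $\mathcal{U}$ be the set of $\mathbb{F}$-adapted (progressively measurable) processes with values in $U$. For $s\in[0,T]$, $x\in X$ and $z\in\mathcal{U}$ let $Y^{s,x,z}$ be the weak solution (with continuous paths) on $[s,T]$ of $$dY(t)=(AY(t)+Bz(t))\,dt+G\,dW_0(t),\qquad Y(s)=x,$$ i.e. a continuous adapted $X$-valued process such that for every $\zeta\in D(A^*)$, almost surely, for all $t\in[s,T]$, $$\langle Y(t),\zeta\rangle=\langle x,\zeta\rangle+\int_s^t\big(\langle Y(u),A^*\zeta\rangle+\langle Bz(u),\zeta\rangle\big)\,du+\langle G(W_0(t)-W_0(s)),\zeta\rangle .$$ Define $$V(s,x)=\sup_{z\in\mathcal{U}}\mathbb{E}\Big[\varphi(Y^{s,x,z}(T))+\int_s^Th(z(t))\,dt\Big].$$ Then for all $s\in[0,T]$, $x\in X$ a weak solution exists for every $z\in\mathcal{U}$, the expectations above are of integrable random variables, and there is a constant $N$, depending only on $T,m,K$ and the data $r,a_0,a_1,b_0,b_1,\sigma,U$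 of the model (in particular not on $s$, $x$, $\varphi_0$, $h_0$), such that $$|V(s,x)|\le N(1+|x|)^m\qquad\text{for all } s\in[0,T],\ x\in X.$$ -/

import Mathlib

open MeasureTheory ProbabilityTheory Set
open scoped NNReal

noncomputable section

/-- `L²([-r,0], ℝ)` with Lebesgue measure. -/
abbrev HistorySpace (r : ℝ) : Type := Lp ℝ 2 (volume.restrict (Icc (-r) 0))

/-- The Hilbert space `X = ℝ × L²([-r,0], ℝ)` with `|x|² = |x₀|² + ∫ |x₁(ξ)|² dξ`. -/
abbrev StateSpace (r : ℝ) : Type := WithLp 2 (ℝ × HistorySpace r)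

/-- The coefficients of the controlled linear equation with delay, with their standing
sign assumptions, and the compact interval `U = [uMin, uMax] ⊆ ℝ₊` of control values. -/
structure DelayModel where
  r : ℝ
  r_pos : 0 < r
  a₀ : ℝ
  a₀_nonpos : a₀ ≤ 0
  a₁ : HistorySpace r
  b₀ : ℝ
  b₀_nonneg : 0 ≤ b₀
  b₁ : HistorySpace r
  b₁_nonneg : ∀ᵐ ξ ∂(volume.restrict (Icc (-r) 0)), 0 ≤ b₁ ξ
  σ : ℝ
  uMin : ℝ≥0
  uMax : ℝ≥0
  uMin_le_uMax : uMin ≤ uMax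

/-- `v` lies in `W^{1,2}([-r,0])`, with derivative `g ∈ L²` and (absolutely) continuous
representative `f` on `[-r,0]`. -/
def IsSobolevRep {r : ℝ} (v g : HistorySpace r) (f : ℝ → ℝ) : Prop :=
  (∀ᵐ ξ ∂(volume.restrict (Icc (-r) 0)), v ξ = f ξ) ∧
    ∀ ξ ∈ Icc (-r) 0, f ξ = f (-r) + ∫ θ in (-r)..ξ, g θ

namespace DelayModel

/-- The set `U` of control values. -/
def U (M : DelayModel) : Set ℝ≥0 := Icc M.uMin M.uMax

/-- The state space of the model. -/
abbrev X (M : DelayModel) : Type := StateSpace M.r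

/-- The graph of the unbounded operator
`A (x₀, x₁) = (a₀ x₀ + x₁(0), a₁ x₀ - x₁')`,
`D(A) = {x : x₁ ∈ W^{1,2}([-r,0]), x₁(-r) = 0}`:
the proposition `M.GraphA v w` says `v ∈ D(A)` and `A v = w`. -/
def GraphA (M : DelayModel) (v w : M.X) : Prop :=
  ∃ (g : HistorySpace M.r) (f : ℝ → ℝ), IsSobolevRep v.snd g f ∧ f (-M.r) = 0 ∧
    w = WithLp.toLp 2 (M.a₀ * v.fst + f 0, v.fst • M.a₁ - g)

/-- The graph of the Hilbert space adjoint `A*`: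
the proposition `M.GraphAdjoint ζ η` says `ζ ∈ D(A*)` and `A* ζ = η`. -/
def GraphAdjoint (M : DelayModel) (ζ η : M.X) : Prop :=
  ∀ v w : M.X, M.GraphA v w → inner ℝ w ζ = inner ℝ v η

/-- The control operator `B u = (b₀ u, b₁ u)`. -/
def B (M : DelayModel) (u : ℝ) : M.X := WithLp.toLp 2 (M.b₀ * u, u • M.b₁)

/-- The noise operator `G w = (σ w, 0)`. -/
def G (M : DelayModel) (w : ℝ) : M.X := WithLp.toLp 2 (M.σ * w, 0)

end DelayModel

section Control

variable {Ω : Type*} [mΩ : MeasurableSpace Ω]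

/-- The filtration generated by `W`, completed by the `P`-null events: an event belongs to the
`σ`-algebra at time `t` if it is `P`-a.e. equal to an event of `σ(W u, u ≤ t)`. -/
def completedFiltration (P : Measure Ω) (W : ℝ≥0 → Ω → ℝ) (hW : ∀ t, StronglyMeasurable (W t)) :
    Filtration ℝ≥0 mΩ where
  seq t := mΩ ⊓ eventuallyMeasurableSpace (Filtration.natural W hW t) (ae P)
  mono' := by
    intro s t hst
    refine inf_le_inf le_rfl ?_
    rintro A ⟨C, hC, hAC⟩
    exact ⟨C, (Filtration.natural W hW).mono hst C hC, hAC⟩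
  le' _ := inf_le_left

/-- Admissible controls: (progressively measurable) processes adapted to the filtration `ℱ` with
values in `U`. -/
def DelayModel.IsAdmissible (M : DelayModel) (ℱ : Filtration ℝ≥0 mΩ) (z : ℝ≥0 → Ω → ℝ≥0) : Prop :=
  IsStronglyProgressive ℱ z ∧ ∀ t ω, z t ω ∈ M.U

/-- `Y` is a weak solution on `[s,T]` of `dY = (A Y + B z) dt + G dW`, `Y(s) = x`: a continuous
adapted `X`-valued process such that, for every `ζ ∈ D(A*)`, almost surely for all `t ∈ [s,T]`,
`⟨Y(t), ζ⟩ = ⟨x, ζ⟩ + ∫ₛᵗ (⟨Y(u), A*ζ⟩ + ⟨B z(u), ζ⟩) du + ⟨G (W(t) - W(s)), ζ⟩`. -/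
structure DelayModel.IsWeakSolution (M : DelayModel) (P : Measure Ω) (ℱ : Filtration ℝ≥0 mΩ)
    (W : ℝ≥0 → Ω → ℝ) (T s : ℝ≥0) (x : M.X) (z : ℝ≥0 → Ω → ℝ≥0) (Y : ℝ≥0 → Ω → M.X) : Prop where
  adapted : ∀ t ∈ Icc s T, StronglyMeasurable[ℱ t] (Y t)
  continuous_paths : ∀ᵐ ω ∂P, ContinuousOn (fun t => Y t ω) (Icc s T)
  weak_eq : ∀ ζ η : M.X, M.GraphAdjoint ζ η → ∀ᵐ ω ∂P, ∀ t ∈ Icc s T,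
    inner ℝ (Y t ω) ζ = inner ℝ x ζ
      + (∫ u in (s : ℝ)..(t : ℝ), (inner ℝ (Y u.toNNReal ω) η + inner ℝ (M.B (z u.toNNReal ω)) ζ))
      + inner ℝ (M.G (W t ω - W s ω)) ζ

/-- The random payoff `φ(Y(T)) + ∫ₛᵀ h(z(t)) dt`, where `φ(x₀, x₁) = φ₀(x₀)` and `h = -h₀`. -/
def DelayModel.payoff (M : DelayModel) (φ₀ : ℝ → ℝ) (h₀ : ℝ≥0 → ℝ≥0) (T s : ℝ≥0)
    (z : ℝ≥0 → Ω → ℝ≥0) (Y : ℝ≥0 → Ω → M.X) (ω : Ω) : ℝ :=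
  φ₀ (Y T ω).fst + ∫ t in (s : ℝ)..(T : ℝ), -(h₀ (z t.toNNReal ω) : ℝ)

/-- The value function `V(s,x) = sup_z E[φ(Y^{s,x,z}(T)) + ∫ₛᵀ h(z(t)) dt]`, as an extended real;
the supremum runs over the admissible controls `z` together with the corresponding weak
solution `Y` of the state equation. -/
def DelayModel.value (M : DelayModel) (P : Measure Ω) (ℱ : Filtration ℝ≥0 mΩ) (W : ℝ≥0 → Ω → ℝ)
    (φ₀ : ℝ → ℝ) (h₀ : ℝ≥0 → ℝ≥0) (T s : ℝ≥0) (x : M.X) : EReal :=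
  ⨆ (z : ℝ≥0 → Ω → ℝ≥0) (_ : M.IsAdmissible ℱ z) (Y : ℝ≥0 → Ω → M.X)
    (_ : M.IsWeakSolution P ℱ W T s x z Y), ((∫ ω, M.payoff φ₀ h₀ T s z Y ω ∂P : ℝ) : EReal)

end Control

end

/-! The equation is linear with additive noise, so the state can be written down path by path. The
history component is transported to the right with zero inflow at `-r` and fed by the sources `y a₁`
and `z b₁`, where `y` is the present value; variation of constants expresses it through convolutions
with `shift`. Integrating the first component in time turns the boundary value `x₁(0)` into the mass
that has left the interval (`outflow`), so `y` solves a scalar Volterra equation with continuous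
kernel `a₀ + outflow a₁`. With its resolvent `ρ` and the free term `F`, `y` is `F` plus the
convolution of `ρ` with `F`. The time integral of this trajectory lies in `D(A)`
(`graphA_integral_trajectory`), which yields the weak equation.

The same formula bounds `1 + |y(T)|` by a constant times `(1 + |x|)` times `1 + |B(T) - B(s)| + ∫ₛᵀ
|B(u) - B(s)| du`, uniformly in the control (`one_add_abs_present_le`). Jensen's inequality and
Gaussian moments then control the expected payoff.

The value is a supremum over all weak solutions, but the payoff sees only the first component of
`Y(T)`, so uniqueness is needed for that component alone. The difference `D` of two solutions,
tested against `(1, e^{nξ})`, solves a scalar linear ODE; integrating it shows that the exponential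
moments `∫ₛᵀ e^{n(T-u)} D₀(u) du` stay bounded in `n`, which forces `D₀ = 0`
(`eq_zero_of_bounded_exp_moments`). -/

noncomputable section

/-! ### Convolutions, exponential moments and Volterra equations -/

section Analysis

open Filter Topology

variable {E : Type*} [NormedAddCommGroup E] [NormedSpace ℝ E]

theorem integrable_prod_smul_of_continuous {a b : ℝ} {q : ℝ → ℝ}
    (hq : IntegrableOn q (Ioc a b)) {c : ℝ → ℝ → E} (hc : Continuous (Function.uncurry c)) :
    Integrable (fun p : ℝ × ℝ => q p.1 • c p.1 p.2)
      ((volume.restrict (Ioc a b)).prod (volume.restrict (Ioc a b))) := by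
  obtain ⟨C, hC⟩ := (isCompact_Icc.prod isCompact_Icc).exists_bound_of_continuousOn
    (s := Icc a b ×ˢ Icc a b) hc.continuousOn
  refine (hq.comp_fst (volume.restrict (Ioc a b))).smul_bdd C hc.aestronglyMeasurable ?_
  rw [Measure.prod_restrict]
  filter_upwards [ae_restrict_mem (measurableSet_Ioc.prod measurableSet_Ioc)] with p hp
  exact hC p ⟨Ioc_subset_Icc_self hp.1, Ioc_subset_Icc_self hp.2⟩

/-- Exchange of the order of integration over the triangle `a ≤ u ≤ v ≤ b`. -/
theorem integral_integral_triangle {a b : ℝ} (hab : a ≤ b) {q : ℝ → ℝ}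
    (hq : IntervalIntegrable q volume a b) {c : ℝ → ℝ → E} (hc : Continuous (Function.uncurry c)) :
    ∫ v in a..b, ∫ u in a..v, q u • c u v = ∫ u in a..b, ∫ v in u..b, q u • c u v := by
  have hq' : IntegrableOn q (Ioc a b) := (intervalIntegrable_iff_integrableOn_Ioc_of_le hab).1 hq
  have hI := (integrable_prod_smul_of_continuous hq' hc).indicator
    (measurableSet_le measurable_fst measurable_snd)
  have hswap := integral_integral_swap
    (f := fun u v => {p : ℝ × ℝ | p.1 ≤ p.2}.indicator (fun p => q p.1 • c p.1 p.2) (u, v)) hI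
  rw [intervalIntegral.integral_of_le hab, intervalIntegral.integral_of_le hab]
  have h1 : ∀ v ∈ Ioc a b, ∫ u in a..v, q u • c u v
      = ∫ u in Ioc a b,
        {p : ℝ × ℝ | p.1 ≤ p.2}.indicator (fun p => q p.1 • c p.1 p.2) (u, v) := by
    intro v hv
    have : (fun u => {p : ℝ × ℝ | p.1 ≤ p.2}.indicator (fun p => q p.1 • c p.1 p.2) (u, v))
        = (Iic v).indicator (fun u => q u • c u v) := by
      ext u; simp [indicator_apply]
    rw [this, setIntegral_indicator measurableSet_Iic, Ioc_inter_Iic, min_eq_right hv.2,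
      intervalIntegral.integral_of_le hv.1.le]
  have h2 : ∀ u ∈ Ioc a b, ∫ v in u..b, q u • c u v
      = ∫ v in Ioc a b,
        {p : ℝ × ℝ | p.1 ≤ p.2}.indicator (fun p => q p.1 • c p.1 p.2) (u, v) := by
    intro u hu
    have : (fun v => {p : ℝ × ℝ | p.1 ≤ p.2}.indicator (fun p => q p.1 • c p.1 p.2) (u, v))
        = (Ici u).indicator (fun v => q u • c u v) := by
      ext v; simp [indicator_apply]
    have hs : Ioc a b ∩ Ici u = Icc u b := by
      ext v; simp only [mem_inter_iff, mem_Ioc, mem_Ici, mem_Icc]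
      exact ⟨fun h => ⟨h.2, h.1.2⟩, fun h => ⟨⟨hu.1.trans_le h.1, h.2⟩, h.1⟩⟩
    rw [this, setIntegral_indicator measurableSet_Ici, hs, integral_Icc_eq_integral_Ioc,
      intervalIntegral.integral_of_le hu.2]
  rw [setIntegral_congr_fun measurableSet_Ioc h1, setIntegral_congr_fun measurableSet_Ioc h2]
  exact hswap.symm

/-- The convolution `∫ₛᵗ q(u) c(t - u) du`, extended by zero to `t < s`. -/
def causalConv (s : ℝ) (c : ℝ → E) (q : ℝ → ℝ) (t : ℝ) : E :=
  ∫ u in s..max s t, q u • c (t - u)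

theorem causalConv_of_le {s t : ℝ} (h : s ≤ t) (c : ℝ → E) (q : ℝ → ℝ) :
    causalConv s c q t = ∫ u in s..t, q u • c (t - u) := by
  rw [causalConv, max_eq_right h]

theorem continuous_causalConv (s : ℝ) {c : ℝ → E} (hc : Continuous c) {q : ℝ → ℝ}
    (hq : LocallyIntegrable q) : Continuous (causalConv s c q) := by
  rw [continuous_iff_continuousAt]
  intro t₀
  obtain ⟨C, hC⟩ := isCompact_Icc.exists_bound_of_continuousOn
    (s := Icc (t₀ - 1 - (max s t₀ + 1)) (t₀ + 1 - (s - 1))) hc.continuousOn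
  have hlt : s - 1 ≤ max s t₀ + 1 := by linarith [le_max_left s t₀]
  -- The ambient interval exceeds `[s, max s t₀]` by `1` on each side, so both end points are
  -- interior; `C` bounds `c (t - u)` there for all `t` within `1` of `t₀`.
  have key := intervalIntegral.continuousAt_parametric_primitive_of_dominated (μ := volume)
    (F := fun t u => q u • c (t - u)) (fun u => ‖q u‖ * C) (s - 1) (max s t₀ + 1)
    (a₀ := s) (b₀ := max s t₀) (x₀ := t₀) ?_ ?_ ?_ ?_ ?_ ?_ ?_
  · exact ContinuousAt.comp (f := fun t => (t, max s t)) (x := t₀) key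
      (by fun_prop)
  · intro t
    exact hq.aestronglyMeasurable.restrict.smul
      (hc.comp (continuous_const.sub continuous_id)).aestronglyMeasurable
  · have : Icc (t₀ - 1) (t₀ + 1) ∈ 𝓝 t₀ := Icc_mem_nhds (by linarith) (by linarith)
    filter_upwards [this] with t ht
    filter_upwards [ae_restrict_mem measurableSet_uIoc] with u hu
    rw [uIoc_of_le hlt] at hu
    rw [norm_smul]
    refine mul_le_mul_of_nonneg_left (hC _ ⟨?_, ?_⟩) (norm_nonneg _)
    · linarith [ht.1, hu.2]
    · linarith [ht.2, hu.1]
  · exact (hq.integrableOn_isCompact isCompact_uIcc).intervalIntegrable.norm.mul_const C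
  · filter_upwards with u
    fun_prop
  · exact ⟨by linarith, by linarith [le_max_left s t₀]⟩
  · exact ⟨by linarith [le_max_left s t₀], by linarith⟩
  · simp

/-- A continuous function on `[0, L]` whose exponential moments `∫₀ᴸ e^{nv} q(v) dv` stay bounded
vanishes. -/
theorem eq_zero_of_bounded_exp_moments {L M : ℝ} {q : ℝ → ℝ} (hq : ContinuousOn q (Icc 0 L))
    {n₀ : ℕ} (hM : ∀ n : ℕ, n₀ ≤ n → |∫ v in (0 : ℝ)..L, Real.exp (n * v) * q v| ≤ M)
    (hL : 0 < L) : ∀ x ∈ Icc 0 L, q x = 0 := by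
  have hqI : IntervalIntegrable q volume 0 L := hq.intervalIntegrable_of_Icc hL.le
  have hqO : IntegrableOn q (Ioc 0 L) := (intervalIntegrable_iff_integrableOn_Ioc_of_le hL.le).1 hqI
  obtain ⟨C, hC⟩ := isCompact_Icc.exists_bound_of_continuousOn hq
  -- the smoothed step function `1 - exp (-e^{n(v-x)})`
  have step : ∀ x ∈ Ioo 0 L, ∀ n : ℕ, n₀ ≤ n →
      |∫ v in (0 : ℝ)..L, (1 - Real.exp (-Real.exp (n * (v - x)))) * q v|
        ≤ M * (Real.exp (Real.exp (-(n * x))) - 1) := by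
    intro x hx n hn
    have hsum : ∀ y : ℝ, HasSum (fun k : ℕ => y ^ (k + 1) / (k + 1).factorial)
        (Real.exp y - 1) := by
      intro y
      have h0 : HasSum (fun k : ℕ => y ^ k / k.factorial) (Real.exp y) := by
        rw [Real.exp_eq_exp_ℝ]; exact NormedSpace.expSeries_div_hasSum_exp y
      simpa using (hasSum_nat_add_iff' (f := fun k : ℕ => y ^ k / (k.factorial : ℝ)) 1).2 h0
    -- Termwise integration of the exponential series in `y = e^{n(v-x)}`. Since `y^(k+1)` is
    -- `e^{-(k+1)nx}` times `e^{(k+1)nv}`, each term is a moment of order `(k+1)n ≥ n₀`, bounded by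
    -- `M`, and the bounds sum to the right-hand side.
    have hS := intervalIntegral.hasSum_integral_of_dominated_convergence (μ := volume) (a := 0)
      (b := L) (F := fun (k : ℕ) v => -((-Real.exp (n * (v - x))) ^ (k + 1) / (k + 1).factorial) * q v)
      (f := fun v => (1 - Real.exp (-Real.exp (n * (v - x)))) * q v)
      (fun k _ => Real.exp (n * (L - x)) ^ (k + 1) / (k + 1).factorial * C) ?_ ?_ ?_ ?_ ?_
    · refine hS.norm_le_of_bounded ((hsum _).mul_left M) fun k => ?_
      have hk : n₀ ≤ (k + 1) * n := hn.trans (Nat.le_mul_of_pos_left n k.succ_pos)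
      have e : ∀ v, -((-Real.exp (n * (v - x))) ^ (k + 1) / (k + 1).factorial) * q v
          = (-((-1) ^ (k + 1) * Real.exp (-(n * x)) ^ (k + 1) / (k + 1).factorial))
            * (Real.exp (((k + 1) * n : ℕ) * v) * q v) := by
        intro v
        have : Real.exp (n * (v - x)) ^ (k + 1)
            = Real.exp (-(n * x)) ^ (k + 1) * Real.exp (((k + 1) * n : ℕ) * v) := by
          rw [← Real.exp_nat_mul, ← Real.exp_nat_mul, ← Real.exp_add]
          congr 1; push_cast; ring
        rw [neg_pow, this]; ring
      simp_rw [e]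
      rw [intervalIntegral.integral_const_mul, norm_mul, norm_neg, norm_div, norm_mul, norm_pow,
        norm_neg, norm_one, one_pow, one_mul, Real.norm_of_nonneg (by positivity),
        Real.norm_of_nonneg (by positivity), mul_comm]
      exact mul_le_mul_of_nonneg_right (hM _ hk) (by positivity)
    · intro k
      rw [uIoc_of_le hL.le]
      refine AEStronglyMeasurable.mul ?_ hqO.aestronglyMeasurable
      exact Continuous.aestronglyMeasurable (by fun_prop)
    · intro k
      filter_upwards with v hv
      rw [uIoc_of_le hL.le] at hv
      rw [norm_mul, norm_neg, norm_div, norm_pow, norm_neg, Real.norm_of_nonneg (Real.exp_nonneg _),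
        Real.norm_of_nonneg (by positivity)]
      refine mul_le_mul ?_ (hC v (Ioc_subset_Icc_self hv)) (norm_nonneg _) (by positivity)
      gcongr
      exact hv.2
    · filter_upwards with v _ using (hsum _).summable.mul_right C
    · exact intervalIntegrable_const
    · filter_upwards with v _
      simpa using ((hsum (-Real.exp (n * (v - x)))).neg).mul_right (q v)
  -- As `n → ∞` the weight tends to `1` for `v > x` and to `0` for `v < x`, while the bound in
  -- `step` tends to `0` because `x > 0`.
  have tail : ∀ x ∈ Ioo 0 L, ∫ v in x..L, q v = 0 := by
    intro x hx
    have hlim : Tendsto (fun n : ℕ => ∫ v in (0 : ℝ)..L,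
        (1 - Real.exp (-Real.exp (n * (v - x)))) * q v) atTop
        (𝓝 (∫ v in (0 : ℝ)..L, (Ioi x).indicator q v)) := by
      refine intervalIntegral.tendsto_integral_filter_of_dominated_convergence (fun _ => C) ?_ ?_ ?_ ?_
      · filter_upwards with n
        rw [uIoc_of_le hL.le]
        refine AEStronglyMeasurable.mul ?_ hqO.aestronglyMeasurable
        exact Continuous.aestronglyMeasurable (by fun_prop)
      · filter_upwards with n
        filter_upwards with v hv
        rw [uIoc_of_le hL.le] at hv
        rw [norm_mul]
        refine (mul_le_of_le_one_left (norm_nonneg _) ?_).trans (hC v (Ioc_subset_Icc_self hv))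
        have h1 : Real.exp (-Real.exp (n * (v - x))) ≤ 1 :=
          Real.exp_le_one_iff.2 (neg_nonpos.2 (Real.exp_nonneg _))
        rw [Real.norm_of_nonneg (by linarith)]
        linarith [Real.exp_nonneg (-Real.exp (n * (v - x)))]
      · exact intervalIntegrable_const
      · have : ∀ᵐ v : ℝ, v ≠ x := by simp [ae_iff]
        filter_upwards [this] with v hv _
        rcases lt_or_gt_of_ne hv with h | h
        · rw [indicator_of_notMem (by simpa using h.le)]
          have h1 : Tendsto (fun n : ℕ => (n : ℝ) * (v - x)) atTop atBot :=
            tendsto_natCast_atTop_atTop.atTop_mul_const_of_neg (by linarith)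
          have h2 := (Real.tendsto_exp_atBot.comp h1).neg.rexp.const_sub 1 |>.mul_const (q v)
          simpa using h2
        · rw [indicator_of_mem (mem_Ioi.2 h)]
          have h1 : Tendsto (fun n : ℕ => (n : ℝ) * (v - x)) atTop atTop :=
            tendsto_natCast_atTop_atTop.atTop_mul_const (by linarith)
          have h2 := (Real.tendsto_exp_atBot.comp
            (tendsto_neg_atTop_atBot.comp (Real.tendsto_exp_atTop.comp h1))).const_sub 1
              |>.mul_const (q v)
          simpa using h2
    have hzero : Tendsto (fun n : ℕ => M * (Real.exp (Real.exp (-(n * x))) - 1)) atTop (𝓝 0) := by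
      have h1 : Tendsto (fun n : ℕ => -((n : ℝ) * x)) atTop atBot :=
        tendsto_neg_atTop_atBot.comp (tendsto_natCast_atTop_atTop.atTop_mul_const hx.1)
      simpa using ((Real.tendsto_exp_atBot.comp h1).rexp.sub_const 1).const_mul M
    have h0 : ∫ v in (0 : ℝ)..L, (Ioi x).indicator q v = 0 := by
      refine tendsto_nhds_unique hlim (squeeze_zero_norm' ?_ hzero)
      filter_upwards [eventually_ge_atTop n₀] with n hn using step x hx n hn
    rw [intervalIntegral.integral_of_le hL.le, setIntegral_indicator measurableSet_Ioi] at h0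
    rw [intervalIntegral.integral_of_le hx.2.le, ← h0]
    congr 2
    ext v; simp only [mem_Ioc, mem_inter_iff, mem_Ioi]
    exact ⟨fun h => ⟨⟨hx.1.trans h.1, h.2⟩, h.1⟩, fun h => ⟨h.2, h.1.2⟩⟩
  have hIoo : ∀ x ∈ Ioo 0 L, q x = 0 := by
    intro x hx
    have hcont : ContinuousAt q x := hq.continuousAt (Icc_mem_nhds hx.1 hx.2)
    have hd := intervalIntegral.integral_hasDerivAt_left
      (f := q) (a := x) (b := L)
      (hqI.mono_set (by rw [uIcc_of_le hL.le, uIcc_of_le hx.2.le]; exact Icc_subset_Icc_left hx.1.le))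
      ((hq.mono Ioo_subset_Icc_self).stronglyMeasurableAtFilter isOpen_Ioo x hx) hcont
    have hz : HasDerivAt (fun u => ∫ v in u..L, q v) 0 x := by
      refine (hasDerivAt_const x (0 : ℝ)).congr_of_eventuallyEq ?_
      filter_upwards [isOpen_Ioo.mem_nhds hx] with u hu using tail u hu
    exact neg_eq_zero.1 (hd.unique hz)
  have := EqOn.of_subset_closure (s := Ioo 0 L) (t := Icc 0 L) (f := q) (g := fun _ => 0)
    hIoo hq continuousOn_const Ioo_subset_Icc_self (by rw [closure_Ioo hL.ne])
  exact fun x hx => this hx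

/-- The resolvent kernel of a linear Volterra equation with continuous convolution kernel `κ`. -/
theorem exists_volterra_resolvent {κ : ℝ → ℝ} (hκ : Continuous κ) {T : ℝ} (hT : 0 ≤ T) :
    ∃ ρ : ℝ → ℝ, Continuous ρ ∧
      ∀ t ∈ Icc 0 T, ρ t = κ t + ∫ u in (0 : ℝ)..t, ρ u * κ (t - u) := by
  obtain ⟨C, hC⟩ := isCompact_Icc.exists_bound_of_continuousOn (s := Icc 0 T) hκ.continuousOn
  have hC0 : 0 ≤ C := (norm_nonneg _).trans (hC 0 ⟨le_rfl, hT⟩)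
  -- With the weight `e^{-lt}` the kernel has integral at most `C / l ≤ 1/2`, so the fixed point map
  -- contracts on all of `[0, T]` at once; the factor `e^{lt}` undoes the weight at the end.
  set l : ℝ := 2 * C + 1 with hl
  have hl0 : 0 < l := by positivity
  set k : ℝ → ℝ := fun t => Real.exp (-l * t) * κ t with hk
  have hkc : Continuous k := by fun_prop
  let Φ : C(Icc (0 : ℝ) T, ℝ) → C(Icc (0 : ℝ) T, ℝ) := fun p =>
    ⟨fun t => k t + ∫ u in (0 : ℝ)..t, IccExtend hT p u * k (t - u), by
      have hp : Continuous (IccExtend hT p) := p.continuous.Icc_extend'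
      have := intervalIntegral.continuous_parametric_intervalIntegral_of_continuous (μ := volume)
        (a₀ := 0) (f := fun (t : Icc (0 : ℝ) T) u => IccExtend hT p u * k (t - u))
        (s := fun t => (t : ℝ)) (by fun_prop) (by fun_prop)
      fun_prop⟩
  have hΦ : ContractingWith (1 / 2) Φ := by
    refine ⟨by norm_num, LipschitzWith.of_dist_le_mul fun p p' => ?_⟩
    rw [ContinuousMap.dist_le (by positivity)]
    intro t
    have hp : Continuous (IccExtend hT p) := p.continuous.Icc_extend'
    have hp' : Continuous (IccExtend hT p') := p'.continuous.Icc_extend'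
    have e : Φ p t - Φ p' t
        = ∫ u in (0 : ℝ)..t, (IccExtend hT p u - IccExtend hT p' u) * k (t - u) := by
      simp only [sub_mul]
      rw [intervalIntegral.integral_sub]
      · simp [Φ]
      · exact Continuous.intervalIntegrable (by fun_prop) _ _
      · exact Continuous.intervalIntegrable (by fun_prop) _ _
    rw [Real.dist_eq, e]
    have hb : ∀ u ∈ Ioc (0 : ℝ) t, ‖(IccExtend hT p u - IccExtend hT p' u) * k (t - u)‖
        ≤ dist p p' * C * Real.exp (-l * (t - u)) := by
      intro u hu
      have h1 : ‖IccExtend hT p u - IccExtend hT p' u‖ ≤ dist p p' := by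
        rw [← dist_eq_norm]; exact ContinuousMap.dist_apply_le_dist _
      have h2 : ‖k (t - u)‖ ≤ C * Real.exp (-l * (t - u)) := by
        rw [hk]; simp only [norm_mul, Real.norm_of_nonneg (Real.exp_nonneg _)]
        rw [mul_comm]
        exact mul_le_mul_of_nonneg_right
          (hC _ ⟨by linarith [hu.2], by linarith [hu.1, t.2.2]⟩) (Real.exp_nonneg _)
      rw [norm_mul, mul_assoc]
      exact mul_le_mul h1 h2 (norm_nonneg _) dist_nonneg
    refine (intervalIntegral.norm_integral_le_of_norm_le t.2.1 (ae_of_all _ hb)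
      (Continuous.intervalIntegrable (by fun_prop) _ _)).trans ?_
    rw [intervalIntegral.integral_const_mul, mul_assoc, mul_comm]
    have hint : ∫ u in (0 : ℝ)..t, Real.exp (-l * (t - u)) = (1 - Real.exp (-l * t)) / l := by
      rw [intervalIntegral.integral_comp_sub_left (fun x => Real.exp (-l * x)),
        intervalIntegral.integral_comp_mul_left (fun x => Real.exp x) (by linarith), integral_exp]
      simp only [sub_self, mul_zero, Real.exp_zero, sub_zero, smul_eq_mul]
      field_simp
      ring
    rw [hint]
    have : C * ((1 - Real.exp (-l * t)) / l) ≤ 1 / 2 := by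
      rw [mul_div_assoc', div_le_div_iff₀ hl0 (by norm_num)]
      nlinarith [mul_nonneg hC0 (Real.exp_nonneg (-l * t))]
    exact (mul_le_mul_of_nonneg_right this dist_nonneg).trans_eq (by simp)
  have hfix : Φ (hΦ.fixedPoint Φ) = hΦ.fixedPoint Φ := hΦ.fixedPoint_isFixedPt
  set p := hΦ.fixedPoint Φ
  have hp : Continuous (IccExtend hT p) := p.continuous.Icc_extend'
  refine ⟨fun t => Real.exp (l * t) * IccExtend hT p t, by fun_prop, fun t ht => ?_⟩
  have h1 : p ⟨t, ht⟩ = k t + ∫ u in (0 : ℝ)..t, IccExtend hT p u * k (t - u) := by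
    conv_lhs => rw [← hfix]
    rfl
  simp only [IccExtend_of_mem hT p ht, h1, mul_add]
  congr 1
  · simp only [hk]
    rw [← mul_assoc, ← Real.exp_add]; simp
  · rw [← intervalIntegral.integral_const_mul]
    refine intervalIntegral.integral_congr fun u _ => ?_
    have : Real.exp (l * t) * Real.exp (-l * (t - u)) = Real.exp (l * u) := by
      rw [← Real.exp_add]; congr 1; ring
    simp only [hk, ← this]; ring

/-- Solution of a linear Volterra equation through the resolvent kernel. -/
theorem volterra_solution {κ ρ F : ℝ → ℝ} (hκ : Continuous κ) (hρ : Continuous ρ)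
    (hF : Continuous F) {T : ℝ}
    (hres : ∀ t ∈ Icc 0 T, ρ t = κ t + ∫ u in (0 : ℝ)..t, ρ u * κ (t - u))
    {s t : ℝ} (hst : s ≤ t) (htT : t - s ≤ T) :
    F t + causalConv s ρ F t
      = F t + causalConv s κ (fun u => F u + causalConv s ρ F u) t := by
  have hconv : Continuous (causalConv s ρ F) := continuous_causalConv s hρ hF.locallyIntegrable
  rw [causalConv_of_le hst, causalConv_of_le hst]
  congr 1
  simp only [smul_eq_mul, add_mul]
  rw [intervalIntegral.integral_add (Continuous.intervalIntegrable (by fun_prop) _ _)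
    (Continuous.intervalIntegrable (by fun_prop) _ _)]
  have h1 : ∫ v in s..t, causalConv s ρ F v * κ (t - v)
      = ∫ v in s..t, ∫ u in s..v, F u • (ρ (v - u) * κ (t - v)) := by
    refine intervalIntegral.integral_congr fun v hv => ?_
    rw [uIcc_of_le hst] at hv
    simp only [causalConv_of_le hv.1, smul_eq_mul]
    rw [← intervalIntegral.integral_mul_const]
    simp only [mul_assoc]
  rw [h1, integral_integral_triangle hst (hF.intervalIntegrable _ _)
    (c := fun u v => ρ (v - u) * κ (t - v)) (by fun_prop),
    ← intervalIntegral.integral_add (Continuous.intervalIntegrable (by fun_prop) _ _)]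
  -- For fixed `u`, the factor of `F u` on the right is the resolvent equation at time `t - u`.
  · refine intervalIntegral.integral_congr fun u hu => ?_
    rw [uIcc_of_le hst] at hu
    simp only [smul_eq_mul]
    rw [intervalIntegral.integral_const_mul, ← mul_add,
      hres (t - u) ⟨by linarith [hu.2], by linarith [hu.1]⟩]
    congr 2
    have := intervalIntegral.integral_comp_sub_right (a := u) (b := t)
      (fun w => ρ w * κ (t - u - w)) u
    rw [sub_self] at this
    rw [← this]
    refine intervalIntegral.integral_congr fun v _ => ?_
    congr 2; ring
  -- The substitution `w = v - u` fixes the lower limit at `0`, so that the inner integral depends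
  -- continuously on `u`.
  · have := intervalIntegral.continuous_parametric_intervalIntegral_of_continuous (μ := volume)
      (f := fun u w => F u • (ρ w * κ (t - u - w))) (a₀ := 0) (s := fun u => t - u)
      (by fun_prop) (by fun_prop)
    refine (this.intervalIntegrable s t).congr ?_
    intro u _
    have h2 := intervalIntegral.integral_comp_sub_right (a := u) (b := t)
      (fun w => F u • (ρ w * κ (t - u - w))) u
    rw [sub_self] at h2
    refine (h2.symm.trans (intervalIntegral.integral_congr fun v _ => ?_))
    congr 3; ring

end Analysis

/-! ### Translation, primitives and exponentials on `L²([-r,0])` -/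

section History

open Filter Topology

variable {r : ℝ}

/-- Extension of an element of `L²([-r,0])` by zero. -/
def zeroExt (f : HistorySpace r) : ℝ → ℝ := (Icc (-r) 0).indicator f

theorem memLp_zeroExt (f : HistorySpace r) : MemLp (zeroExt f) 2 volume :=
  (memLp_indicator_iff_restrict measurableSet_Icc).2 (Lp.memLp f)

theorem integrable_zeroExt (f : HistorySpace r) : Integrable (zeroExt f) :=
  (integrable_indicator_iff measurableSet_Icc).2 ((Lp.memLp f).integrable (by norm_num))

theorem zeroExt_of_mem (f : HistorySpace r) {ξ : ℝ} (h : ξ ∈ Icc (-r) 0) : zeroExt f ξ = f ξ :=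
  indicator_of_mem h _

/-- The right translation by `τ` on `L²([-r,0])`, filling up with zeros. -/
def shift (τ : ℝ) (f : HistorySpace r) : HistorySpace r :=
  LpToLpRestrictCLM ℝ ℝ ℝ volume 2 (Icc (-r) 0) (DomAddAct.mk (-τ) +ᵥ (memLp_zeroExt f).toLp)

theorem shift_ae_eq (τ : ℝ) (f : HistorySpace r) :
    ∀ᵐ ξ ∂(volume.restrict (Icc (-r) 0)), shift τ f ξ = zeroExt f (ξ - τ) := by
  have h1 := LpToLpRestrictCLM_coeFn ℝ (Icc (-r) 0)
    (DomAddAct.mk (-τ) +ᵥ (memLp_zeroExt f).toLp : Lp ℝ 2 (volume : Measure ℝ))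
  rw [DomAddAct.mk_vadd_toLp] at h1
  have h2 : ∀ᵐ ξ ∂(volume.restrict (Icc (-r) 0)),
      (((memLp_zeroExt f).comp_measurePreserving (measurePreserving_vadd (-τ) volume)).toLp
        (fun x => zeroExt f (-τ +ᵥ x))) ξ = zeroExt f (-τ +ᵥ ξ) :=
    ae_restrict_of_ae (MemLp.coeFn_toLp _)
  filter_upwards [h1, h2] with ξ h1 h2
  rw [shift, DomAddAct.mk_vadd_toLp, h1, h2, vadd_eq_add, neg_add_eq_sub]

/-- Translations act strongly continuously on `L²(ℝ)`, and restriction to `[-r,0]` is bounded. -/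
theorem continuous_shift (f : HistorySpace r) : Continuous fun τ => shift τ f := by
  have h : Continuous fun τ : ℝ => DomAddAct.mk (-τ) :=
    DomAddAct.continuous_mk.comp continuous_neg
  have : Fact ((2 : ENNReal) ≠ ⊤) := ⟨by norm_num⟩
  have h2 : Continuous fun τ : ℝ =>
      (DomAddAct.mk (-τ) +ᵥ (memLp_zeroExt f).toLp : Lp ℝ 2 (volume : Measure ℝ)) :=
    h.vadd continuous_const
  exact (ContinuousLinearMap.continuous _).comp h2

theorem norm_shift_le (τ : ℝ) (f : HistorySpace r) : ‖shift τ f‖ ≤ ‖f‖ := by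
  have h1 : ‖shift τ f‖ ≤ ‖(memLp_zeroExt f).toLp‖ := by
    rw [← DomAddAct.norm_vadd_Lp (DomAddAct.mk (-τ)) ((memLp_zeroExt f).toLp)]
    exact norm_Lp_toLp_restrict_le _ _
  refine h1.trans_eq ?_
  rw [Lp.norm_toLp, Lp.norm_def, zeroExt, eLpNorm_indicator_eq_eLpNorm_restrict measurableSet_Icc]

theorem integrable_history (g : HistorySpace r) : IntegrableOn g (Icc (-r) 0) :=
  (Lp.memLp g).integrable (by norm_num)

theorem intervalIntegrable_history (g : HistorySpace r) {a b : ℝ} (ha : a ∈ Icc (-r) 0)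
    (hb : b ∈ Icc (-r) 0) : IntervalIntegrable g volume a b :=
  ((integrable_history g).mono_set (ordConnected_Icc.uIcc_subset ha hb)).intervalIntegrable

theorem setIntegral_history_eq_intervalIntegral (hr : 0 ≤ r) (F : ℝ → ℝ) :
    ∫ ξ in Icc (-r) 0, F ξ = ∫ ξ in (-r)..0, F ξ := by
  rw [intervalIntegral.integral_of_le (by linarith), integral_Icc_eq_integral_Ioc]

theorem memLp_history_of_continuous (r : ℝ) {e : ℝ → ℝ} (he : Continuous e) :
    MemLp e 2 (volume.restrict (Icc (-r) 0)) := by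
  obtain ⟨C, hC⟩ := isCompact_Icc.exists_bound_of_continuousOn (s := Icc (-r) 0) he.continuousOn
  exact MemLp.of_bound he.aestronglyMeasurable C
    (by filter_upwards [ae_restrict_mem measurableSet_Icc] with ξ hξ using hC ξ hξ)

/-- A continuous function as an element of `L²([-r,0])`. -/
def ofContinuous (r : ℝ) {e : ℝ → ℝ} (he : Continuous e) : HistorySpace r :=
  (memLp_history_of_continuous r he).toLp

theorem ofContinuous_ae_eq (r : ℝ) {e : ℝ → ℝ} (he : Continuous e) :
    ∀ᵐ ξ ∂(volume.restrict (Icc (-r) 0)), ofContinuous r he ξ = e ξ :=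
  MemLp.coeFn_toLp _

theorem inner_history (f g : HistorySpace r) :
    inner ℝ f g = ∫ ξ in Icc (-r) 0, f ξ * g ξ := by
  rw [L2.inner_def]
  refine integral_congr_ae (ae_of_all _ fun ξ => ?_)
  simp [mul_comm]

theorem inner_ofContinuous {e : ℝ → ℝ} (he : Continuous e) (g : HistorySpace r) :
    inner ℝ (ofContinuous r he) g = ∫ ξ in Icc (-r) 0, e ξ * g ξ := by
  rw [inner_history]
  refine integral_congr_ae ?_
  filter_upwards [ofContinuous_ae_eq r he] with ξ hξ
  rw [hξ]

theorem continuous_primitive_zeroExt (g : HistorySpace r) :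
    Continuous fun ξ => ∫ θ in (-r)..ξ, zeroExt g θ :=
  intervalIntegral.continuous_primitive (fun _ _ => (integrable_zeroExt g).intervalIntegrable) _

theorem intervalIntegral_zeroExt (g : HistorySpace r) {a b : ℝ} (ha : a ∈ Icc (-r) 0)
    (hb : b ∈ Icc (-r) 0) : ∫ θ in a..b, zeroExt g θ = ∫ θ in a..b, g θ :=
  intervalIntegral.integral_congr fun _ hθ =>
    zeroExt_of_mem g (ordConnected_Icc.uIcc_subset ha hb hθ)

theorem neg_left_mem_history (hr : 0 ≤ r) : -r ∈ Icc (-r) 0 := ⟨le_rfl, by linarith⟩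

theorem zero_mem_history (hr : 0 ≤ r) : (0 : ℝ) ∈ Icc (-r) 0 := ⟨by linarith, le_rfl⟩

/-- The primitive `ξ ↦ ∫_{-r}^ξ g` as an element of `L²([-r,0])`. -/
def primitive (g : HistorySpace r) : HistorySpace r :=
  ofContinuous r (continuous_primitive_zeroExt g)

theorem primitive_ae_eq (g : HistorySpace r) :
    ∀ᵐ ξ ∂(volume.restrict (Icc (-r) 0)), primitive g ξ = ∫ θ in (-r)..ξ, g θ := by
  filter_upwards [ofContinuous_ae_eq r (continuous_primitive_zeroExt g),
    ae_restrict_mem measurableSet_Icc] with ξ h hξ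
  rw [primitive, h, intervalIntegral_zeroExt g ⟨le_rfl, hξ.1.trans hξ.2⟩ hξ]

theorem intervalIntegral_congr_history {F G : ℝ → ℝ}
    (h : ∀ᵐ ξ ∂(volume.restrict (Icc (-r) 0)), F ξ = G ξ) {a b : ℝ} (ha : a ∈ Icc (-r) 0)
    (hb : b ∈ Icc (-r) 0) : ∫ θ in a..b, F θ = ∫ θ in a..b, G θ := by
  refine intervalIntegral.integral_congr_ae ?_
  filter_upwards [(ae_restrict_iff' measurableSet_Icc).1 h] with ξ h hξ
  exact h (ordConnected_Icc.uIcc_subset ha hb (uIoc_subset_uIcc hξ))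

theorem primitive_add (f g : HistorySpace r) : primitive (f + g) = primitive f + primitive g := by
  refine Lp.ext ?_
  filter_upwards [primitive_ae_eq f, primitive_ae_eq g, primitive_ae_eq (f + g),
    Lp.coeFn_add (primitive f) (primitive g), ae_restrict_mem measurableSet_Icc]
    with ξ hf hg hfg hadd hξ
  have hr : -r ∈ Icc (-r) 0 := ⟨le_rfl, hξ.1.trans hξ.2⟩
  rw [hfg, hadd, Pi.add_apply, hf, hg, intervalIntegral_congr_history (Lp.coeFn_add f g) hr hξ]
  exact intervalIntegral.integral_add (intervalIntegrable_history f hr hξ)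
    (intervalIntegrable_history g hr hξ)

theorem primitive_smul (c : ℝ) (f : HistorySpace r) : primitive (c • f) = c • primitive f := by
  refine Lp.ext ?_
  filter_upwards [primitive_ae_eq f, primitive_ae_eq (c • f), Lp.coeFn_smul c (primitive f),
    ae_restrict_mem measurableSet_Icc] with ξ hf hcf hsmul hξ
  have hr : -r ∈ Icc (-r) 0 := ⟨le_rfl, hξ.1.trans hξ.2⟩
  rw [hcf, hsmul, Pi.smul_apply, hf, intervalIntegral_congr_history (Lp.coeFn_smul c f) hr hξ]
  simp

/-- The constant function `1` in `L²([-r,0])`. -/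
def oneHist (r : ℝ) : HistorySpace r := ofContinuous r (e := fun _ => 1) continuous_const

/-- For `v = primitive g` this number is the boundary value `v(0)` occurring in `A`. -/
theorem inner_oneHist (hr : 0 ≤ r) (g : HistorySpace r) :
    inner ℝ (oneHist r) g = ∫ ξ in (-r)..0, g ξ := by
  rw [oneHist, inner_ofContinuous, setIntegral_history_eq_intervalIntegral hr]
  simp

theorem setIntegral_norm_history_le (g : HistorySpace r) :
    ∫ ξ in Icc (-r) 0, ‖g ξ‖ ≤ ‖oneHist r‖ * ‖g‖ := by
  have h1 : ∀ᵐ ξ ∂(volume.restrict (Icc (-r) 0)), |g| ξ = |g ξ| := Lp.coeFn_abs g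
  have h := real_inner_le_norm (oneHist r) |g|
  rw [norm_abs_eq_norm, oneHist, inner_ofContinuous] at h
  refine le_of_eq_of_le (integral_congr_ae ?_) h
  filter_upwards [h1] with ξ h
  rw [h, one_mul, Real.norm_eq_abs]

/-- Integration from `-r` as a bounded operator on `L²([-r,0])`. -/
def primitiveCLM (r : ℝ) : HistorySpace r →L[ℝ] HistorySpace r :=
  LinearMap.mkContinuous
    { toFun := primitive, map_add' := primitive_add, map_smul' := primitive_smul }
    -- By Cauchy-Schwarz the primitive is bounded pointwise by `‖oneHist r‖ * ‖g‖`; the square root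
    -- of the total mass passes from the sup norm to `L²`.
    (measureUnivNNReal (volume.restrict (Icc (-r) 0)) ^ (2 : ENNReal).toReal⁻¹ * ‖oneHist r‖) <| by
      intro g
      rw [mul_assoc]
      refine Lp.norm_le_of_ae_bound (by positivity) ?_
      filter_upwards [primitive_ae_eq g, ae_restrict_mem measurableSet_Icc] with ξ h hξ
      simp only [LinearMap.coe_mk, AddHom.coe_mk]
      rw [h]
      refine (intervalIntegral.norm_integral_le_integral_norm hξ.1).trans ?_
      rw [intervalIntegral.integral_of_le hξ.1]
      refine le_trans ?_ (setIntegral_norm_history_le g)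
      exact setIntegral_mono_set (integrable_history g).norm (ae_of_all _ fun _ => norm_nonneg _)
        (Ioc_subset_Icc_self.trans (Icc_subset_Icc_right hξ.2)).eventuallyLE

theorem primitiveCLM_apply (g : HistorySpace r) : primitiveCLM r g = primitive g := rfl

theorem zeroExt_eq_zero_of_lt (f : HistorySpace r) {ξ : ℝ} (h : ξ < -r) : zeroExt f ξ = 0 :=
  indicator_of_notMem (fun h' => absurd h'.1 (not_le.2 h)) _

/-- The integrated translation semigroup: `∫₀^τ S(u) f du` is the primitive of `f - S(τ) f`. -/
theorem integral_shift (hr : 0 ≤ r) (f : HistorySpace r) {τ : ℝ} (hτ : 0 ≤ τ) :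
    ∫ u in (0 : ℝ)..τ, shift u f = primitive (f - shift τ f) := by
  -- Testing against `h` and applying Fubini reduces the claim to a pointwise one: the integral of
  -- `zeroExt f (ξ - u)` over `u ∈ [0, τ]` is that of `zeroExt f` over `[ξ - τ, ξ]`.
  refine ext_inner_left ℝ fun h => ?_
  have hint : IntervalIntegrable (fun u => shift u f) volume 0 τ :=
    (continuous_shift f).intervalIntegrable _ _
  have e1 : inner ℝ h (∫ u in (0 : ℝ)..τ, shift u f)
      = ∫ u in (0 : ℝ)..τ, inner ℝ h (shift u f) :=
    ((innerSL ℝ h).intervalIntegral_comp_comm hint).symm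
  have e2 : ∀ u, inner ℝ h (shift u f) = ∫ ξ, zeroExt h ξ * zeroExt f (ξ - u) := by
    intro u
    rw [inner_history, ← integral_indicator measurableSet_Icc]
    have : ∀ᵐ ξ ∂(volume.restrict (Icc (-r) 0)), h ξ * shift u f ξ = h ξ * zeroExt f (ξ - u) := by
      filter_upwards [shift_ae_eq u f] with ξ hξ
      rw [hξ]
    rw [integral_indicator measurableSet_Icc, integral_congr_ae this,
      ← integral_indicator measurableSet_Icc]
    congr 1
    ext ξ
    exact indicator_mul_left _ _ _
  simp_rw [e2] at e1
  have hconv : Integrable (fun p : ℝ × ℝ => zeroExt h p.2 * zeroExt f (p.2 - p.1))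
      ((volume : Measure ℝ).prod volume) := by
    have := (integrable_zeroExt h).convolution_integrand (ContinuousLinearMap.mul ℝ ℝ)
      (integrable_zeroExt f).comp_neg
    simpa using this
  have hconv' : Integrable (fun p : ℝ × ℝ => zeroExt h p.2 * zeroExt f (p.2 - p.1))
      ((volume.restrict (uIoc 0 τ)).prod (volume : Measure ℝ)) := by
    have h3 := hconv.integrableOn (s := uIoc 0 τ ×ˢ univ)
    rwa [IntegrableOn, ← Measure.prod_restrict, Measure.restrict_univ] at h3
  rw [e1, intervalIntegral_integral_swap (f := fun u ξ => zeroExt h ξ * zeroExt f (ξ - u)) hconv',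
    inner_history, ← integral_indicator measurableSet_Icc]
  have hp := (ae_restrict_iff' measurableSet_Icc).1 (primitive_ae_eq (f - shift τ f))
  refine integral_congr_ae ?_
  filter_upwards [hp] with ξ hp
  rw [intervalIntegral.integral_const_mul]
  by_cases hξ : ξ ∈ Icc (-r) 0
  swap
  · rw [indicator_of_notMem hξ, zeroExt, indicator_of_notMem hξ, zero_mul]
  rw [indicator_of_mem hξ, hp hξ, zeroExt_of_mem h hξ]
  congr 1
  have hI : ∀ a b : ℝ, IntervalIntegrable (zeroExt f) volume a b :=
    fun a b => (integrable_zeroExt f).intervalIntegrable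
  have hr' := neg_left_mem_history hr
  have e3 : ∫ θ in (-r)..ξ, (f - shift τ f : HistorySpace r) θ
      = ∫ θ in (-r)..ξ, (zeroExt f θ - zeroExt f (θ - τ)) := by
    refine intervalIntegral_congr_history ?_ hr' hξ
    filter_upwards [Lp.coeFn_sub f (shift τ f), shift_ae_eq τ f,
      ae_restrict_mem measurableSet_Icc] with θ h1 h2 hθ
    rw [h1, Pi.sub_apply, h2, zeroExt_of_mem f hθ]
  -- Nothing flows in at the left end, so the translated integral may start at `-r` again.
  have h0 : ∫ θ in (-r - τ)..(-r), zeroExt f θ = 0 := by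
    rw [intervalIntegral.integral_of_le (by linarith), ← integral_Ico_eq_integral_Ioc]
    exact setIntegral_eq_zero_of_forall_eq_zero fun θ hθ => zeroExt_eq_zero_of_lt f hθ.2
  rw [e3, intervalIntegral.integral_sub (hI _ _) ((integrable_zeroExt f).comp_sub_right τ).intervalIntegrable,
    intervalIntegral.integral_comp_sub_right (fun θ => zeroExt f θ),
    intervalIntegral.integral_comp_sub_left (fun θ => zeroExt f θ), sub_zero]
  have h4 := intervalIntegral.integral_add_adjacent_intervals (hI (-r - τ) (-r)) (hI (-r) (ξ - τ))
  have h5 := intervalIntegral.integral_add_adjacent_intervals (hI (-r) (ξ - τ)) (hI (ξ - τ) ξ)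
  linarith

/-- The mass that has left `[-r,0]` through the right end when `f` is translated by `τ`. -/
def outflow (f : HistorySpace r) (τ : ℝ) : ℝ := inner ℝ (oneHist r) (f - shift τ f)

theorem continuous_outflow (f : HistorySpace r) : Continuous (outflow f) :=
  continuous_const.inner (continuous_const.sub (continuous_shift f))

theorem abs_outflow_le (f : HistorySpace r) (τ : ℝ) : |outflow f τ| ≤ 2 * ‖oneHist r‖ * ‖f‖ := by
  refine (abs_real_inner_le_norm _ _).trans ?_
  have := (norm_sub_le f (shift τ f)).trans (add_le_add_right (norm_shift_le τ f) _)
  nlinarith [norm_nonneg (oneHist r)]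

/-- The exponential `ξ ↦ e^{λ ξ}` in `L²([-r,0])`. -/
def expHist (r l : ℝ) : HistorySpace r :=
  ofContinuous r (e := fun ξ => Real.exp (l * ξ)) (by fun_prop)

/-- Integration by parts, carried out by Fubini: the primitive vanishes at `-r`, so only the
boundary term at `0` survives. -/
theorem inner_primitive_expHist (hr : 0 ≤ r) (g : HistorySpace r) (l : ℝ) :
    l * inner ℝ (primitive g) (expHist r l)
      = inner ℝ (oneHist r) g - inner ℝ g (expHist r l) := by
  have hr' := neg_left_mem_history hr
  have h0 := zero_mem_history hr
  have hle : -r ≤ 0 := by linarith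
  have hg := intervalIntegrable_history g hr' h0
  rw [real_inner_comm (expHist r l), real_inner_comm (expHist r l) g, expHist,
    inner_ofContinuous, inner_ofContinuous, inner_oneHist hr, setIntegral_history_eq_intervalIntegral hr,
    setIntegral_history_eq_intervalIntegral hr]
  have e1 : ∫ ξ in (-r)..0, Real.exp (l * ξ) * primitive g ξ
      = ∫ ξ in (-r)..0, ∫ θ in (-r)..ξ, g θ • Real.exp (l * ξ) := by
    refine intervalIntegral_congr_history ?_ hr' h0
    filter_upwards [primitive_ae_eq g] with ξ h
    simp only [smul_eq_mul]
    rw [h, intervalIntegral.integral_mul_const, mul_comm]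
  have e2 : ∀ θ, l * ∫ ξ in θ..0, g θ • Real.exp (l * ξ) = g θ - Real.exp (l * θ) * g θ := by
    intro θ
    have hd : ∀ ξ ∈ uIcc θ 0, HasDerivAt (fun ξ => Real.exp (l * ξ)) (l * Real.exp (l * ξ)) ξ := by
      intro ξ _
      simpa [mul_comm] using ((hasDerivAt_id ξ).const_mul l).exp
    have := intervalIntegral.integral_eq_sub_of_hasDerivAt hd
      (Continuous.intervalIntegrable (by fun_prop) _ _)
    rw [intervalIntegral.integral_const_mul] at this
    simp only [smul_eq_mul, intervalIntegral.integral_const_mul]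
    rw [mul_left_comm, this]
    simp; ring
  rw [e1, integral_integral_triangle hle hg (c := fun _ ξ => Real.exp (l * ξ)) (by fun_prop),
    ← intervalIntegral.integral_const_mul]
  simp_rw [e2]
  exact intervalIntegral.integral_sub hg
    (hg.continuousOn_mul (f := g) (by fun_prop))

end History

/-! ### The generator and its adjoint on exponentials -/

namespace DelayModel

variable (M : DelayModel)

/-- Vanishing at `-r` forces the continuous representative to be the primitive of its derivative.
This removes pointwise representatives from all later arguments. -/
theorem graphA_iff (v w : M.X) : M.GraphA v w ↔ ∃ g : HistorySpace M.r, v.snd = primitive g ∧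
    w = WithLp.toLp 2 (M.a₀ * v.fst + inner ℝ (oneHist M.r) g, v.fst • M.a₁ - g) := by
  have hr := M.r_pos.le
  constructor
  · rintro ⟨g, f, ⟨hf1, hf2⟩, hf0, rfl⟩
    refine ⟨g, Lp.ext ?_, ?_⟩
    · filter_upwards [hf1, primitive_ae_eq g, ae_restrict_mem measurableSet_Icc] with ξ h1 h2 hξ
      rw [h1, h2, hf2 ξ hξ, hf0, zero_add]
    · rw [inner_oneHist hr, hf2 0 (zero_mem_history hr), hf0, zero_add]
  · rintro ⟨g, hv, rfl⟩
    refine ⟨g, fun ξ => ∫ θ in (-M.r)..ξ, g θ, ⟨?_, fun ξ _ => by simp⟩, by simp, ?_⟩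
    · rw [hv]; exact primitive_ae_eq g
    · rw [inner_oneHist hr]

theorem inner_toLp (p : ℝ × HistorySpace M.r) (v : M.X) :
    inner ℝ (WithLp.toLp 2 p : M.X) v = p.1 * v.fst + inner ℝ p.2 v.snd := by
  rw [WithLp.prod_inner_apply]
  simp [mul_comm]

theorem inner_toLp_right (v : M.X) (p : ℝ × HistorySpace M.r) :
    inner ℝ v (WithLp.toLp 2 p : M.X) = v.fst * p.1 + inner ℝ v.snd p.2 := by
  rw [real_inner_comm, inner_toLp, real_inner_comm, mul_comm]

/-- `A*` acts on the exponential test vectors `(1, e^{λξ})`. -/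
theorem graphAdjoint_exp (l : ℝ) :
    M.GraphAdjoint (WithLp.toLp 2 (1, expHist M.r l))
      (WithLp.toLp 2 (M.a₀ + inner ℝ M.a₁ (expHist M.r l), l • expHist M.r l)) := by
  intro v w hvw
  obtain ⟨g, hv, rfl⟩ := (M.graphA_iff v w).1 hvw
  rw [inner_toLp_right, inner_toLp_right]
  simp only [WithLp.toLp_fst, WithLp.toLp_snd, inner_sub_left, inner_smul_left, inner_smul_right,
    hv, conj_trivial]
  linarith [inner_primitive_expHist M.r_pos.le g l]

end DelayModel

/-! ### The transport equation with a distributed source -/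

section Transport

variable {r : ℝ}

theorem intervalIntegrable_smul_shift (f : HistorySpace r) {q : ℝ → ℝ} (hq : LocallyIntegrable q)
    (s t : ℝ) : IntervalIntegrable (fun u => q u • shift (t - u) f) volume s t :=
  (hq.integrableOn_isCompact isCompact_uIcc).intervalIntegrable.smul_continuousOn
    ((continuous_shift f).comp (continuous_const.sub continuous_id)).continuousOn

theorem integral_sub_causalConv_shift (f : HistorySpace r) {q : ℝ → ℝ}
    (hq : LocallyIntegrable q) {s t : ℝ} (hst : s ≤ t) :
    (∫ u in s..t, q u) • f - causalConv s (fun τ => shift τ f) q t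
      = ∫ u in s..t, q u • (f - shift (t - u) f) := by
  have hqI : IntervalIntegrable q volume s t :=
    (hq.integrableOn_isCompact isCompact_uIcc).intervalIntegrable
  simp only [smul_sub]
  rw [causalConv_of_le hst, intervalIntegral.integral_sub (hqI.smul_continuousOn continuousOn_const)
    (intervalIntegrable_smul_shift f hq s t), intervalIntegral.integral_smul_const]

theorem intervalIntegrable_smul_sub_shift (f : HistorySpace r) {q : ℝ → ℝ}
    (hq : LocallyIntegrable q) (s t : ℝ) :
    IntervalIntegrable (fun u => q u • (f - shift (t - u) f)) volume s t :=
  (hq.integrableOn_isCompact isCompact_uIcc).intervalIntegrable.smul_continuousOn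
    (continuous_const.sub
      ((continuous_shift f).comp (continuous_const.sub continuous_id))).continuousOn

/-- The transport equation with distributed source `q(t) f` in integrated form. -/
theorem integral_causalConv_shift (hr : 0 ≤ r) (f : HistorySpace r) {q : ℝ → ℝ}
    (hq : LocallyIntegrable q) {s t : ℝ} (hst : s ≤ t) :
    ∫ v in s..t, causalConv s (fun τ => shift τ f) q v
      = primitive ((∫ u in s..t, q u) • f - causalConv s (fun τ => shift τ f) q t) := by
  have hqI : IntervalIntegrable q volume s t :=
    (hq.integrableOn_isCompact isCompact_uIcc).intervalIntegrable
  rw [integral_sub_causalConv_shift f hq hst, ← primitiveCLM_apply,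
    ← ContinuousLinearMap.intervalIntegral_comp_comm _ (intervalIntegrable_smul_sub_shift f hq s t)]
  have h1 : ∫ v in s..t, causalConv s (fun τ => shift τ f) q v
      = ∫ v in s..t, ∫ u in s..v, q u • shift (v - u) f := by
    refine intervalIntegral.integral_congr fun v hv => ?_
    rw [uIcc_of_le hst] at hv
    exact causalConv_of_le hv.1 _ _
  -- After the exchange, each source time `u` contributes the integrated translation semigroup over
  -- the elapsed time `t - u`.
  rw [h1, integral_integral_triangle hst hqI (c := fun u v => shift (v - u) f)
    ((continuous_shift f).comp (continuous_snd.sub continuous_fst))]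
  refine intervalIntegral.integral_congr fun u hu => ?_
  rw [uIcc_of_le hst] at hu
  rw [map_smul, primitiveCLM_apply, intervalIntegral.integral_smul,
    intervalIntegral.integral_comp_sub_right (fun v => shift v f), sub_self,
    integral_shift hr f (by linarith [hu.2])]

/-- The left side is the value at `0` of the primitive in `integral_causalConv_shift`. This is how
the boundary value in `A` becomes a convolution term of the Volterra equation. -/
theorem inner_oneHist_sub_causalConv (f : HistorySpace r) {q : ℝ → ℝ}
    (hq : LocallyIntegrable q) {s t : ℝ} (hst : s ≤ t) :
    inner ℝ (oneHist r) ((∫ u in s..t, q u) • f - causalConv s (fun τ => shift τ f) q t)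
      = causalConv s (outflow f) q t := by
  rw [integral_sub_causalConv_shift f hq hst, causalConv_of_le hst]
  have := (innerSL ℝ (oneHist r)).intervalIntegral_comp_comm
    (intervalIntegrable_smul_sub_shift f hq s t)
  simp only [innerSL_apply_apply] at this
  rw [← this]
  refine intervalIntegral.integral_congr fun u _ => ?_
  simp only [inner_smul_right, smul_eq_mul, outflow]

theorem causalConv_const_add {q : ℝ → ℝ} (hq : LocallyIntegrable q) {k : ℝ → ℝ}
    (hk : Continuous k) (a : ℝ) {s t : ℝ} (hst : s ≤ t) :
    causalConv s (fun τ => a + k τ) q t = a * (∫ u in s..t, q u) + causalConv s k q t := by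
  have hqI : IntervalIntegrable q volume s t :=
    (hq.integrableOn_isCompact isCompact_uIcc).intervalIntegrable
  rw [causalConv_of_le hst, causalConv_of_le hst, ← intervalIntegral.integral_const_mul,
    ← intervalIntegral.integral_add (hqI.const_mul a)
      (hqI.smul_continuousOn (g := fun u => k (t - u)) (by fun_prop))]
  refine intervalIntegral.integral_congr fun u _ => ?_
  simp only [smul_eq_mul]; ring

theorem norm_causalConv_le {q k : ℝ → ℝ} {s t C : ℝ} (hst : s ≤ t)
    (hk : ∀ u ∈ Icc s t, |k (t - u)| ≤ C) (hq : LocallyIntegrable q) :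
    |causalConv s k q t| ≤ C * ∫ u in s..t, |q u| := by
  have hqI : IntervalIntegrable q volume s t :=
    (hq.integrableOn_isCompact isCompact_uIcc).intervalIntegrable
  rw [causalConv_of_le hst, ← intervalIntegral.integral_const_mul, ← Real.norm_eq_abs]
  refine intervalIntegral.norm_integral_le_of_norm_le hst (ae_of_all _ fun u hu => ?_)
    (hqI.abs.const_mul C)
  rw [smul_eq_mul, norm_mul, mul_comm]
  exact mul_le_mul_of_nonneg_right (hk u (Ioc_subset_Icc_self hu)) (norm_nonneg _)

end Transport

/-! ### The explicit trajectory, its equation and its growth -/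

namespace DelayModel

variable (M : DelayModel)

/-- The kernel of the Volterra equation solved by the present value of the state. -/
def kernel (τ : ℝ) : ℝ := M.a₀ + outflow M.a₁ τ

theorem continuous_kernel : Continuous M.kernel :=
  continuous_const.add (continuous_outflow M.a₁)

/-- The free term of that Volterra equation, for initial state `x` at time `s`, noise path `w` and
control path `z`. -/
def forcing (s : ℝ) (x : M.X) (w z : ℝ → ℝ) (t : ℝ) : ℝ :=
  x.fst + outflow x.snd (t - s) + w t + causalConv s (fun τ => M.b₀ + outflow M.b₁ τ) z t

/-- The present value of the state, `ρ` being the resolvent of `M.kernel`. -/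
def present (ρ : ℝ → ℝ) (s : ℝ) (x : M.X) (w z : ℝ → ℝ) (t : ℝ) : ℝ :=
  M.forcing s x w z t + causalConv s ρ (M.forcing s x w z) t

/-- The state trajectory. -/
def trajectory (ρ : ℝ → ℝ) (s : ℝ) (x : M.X) (w z : ℝ → ℝ) (t : ℝ) : M.X :=
  WithLp.toLp 2 (M.present ρ s x w z t, shift (t - s) x.snd
    + causalConv s (fun τ => shift τ M.a₁) (M.present ρ s x w z) t
    + causalConv s (fun τ => shift τ M.b₁) z t)

variable {ρ : ℝ → ℝ} (s : ℝ) (x : M.X) {w z : ℝ → ℝ}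

theorem continuous_forcing (hw : Continuous w) (hz : LocallyIntegrable z) :
    Continuous (M.forcing s x w z) := by
  unfold forcing
  have h1 := (continuous_outflow x.snd).comp (continuous_id.sub (continuous_const (y := s)))
  have h2 := continuous_causalConv s
    (continuous_const.add (continuous_outflow M.b₁) : Continuous fun τ => M.b₀ + outflow M.b₁ τ) hz
  exact ((continuous_const.add h1).add hw).add h2

theorem continuous_present (hρ : Continuous ρ) (hw : Continuous w) (hz : LocallyIntegrable z) :
    Continuous (M.present ρ s x w z) :=
  (M.continuous_forcing s x hw hz).add
    (continuous_causalConv s hρ (M.continuous_forcing s x hw hz).locallyIntegrable)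

theorem continuous_trajectory (hρ : Continuous ρ) (hw : Continuous w) (hz : LocallyIntegrable z) :
    Continuous (M.trajectory ρ s x w z) := by
  have h0 := M.continuous_present s x hρ hw hz
  have h1 := (continuous_shift x.snd).comp (continuous_id.sub (continuous_const (y := s)))
  have h2 := continuous_causalConv s (continuous_shift M.a₁) h0.locallyIntegrable
  have h3 := continuous_causalConv s (continuous_shift M.b₁) hz
  exact (WithLp.prod_continuous_toLp 2 ℝ (HistorySpace M.r)).comp
    (h0.prodMk ((h1.add h2).add h3))

theorem B_eq_smul (u : ℝ) : M.B u = u • M.B 1 := by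
  simp [B, ← WithLp.toLp_smul, mul_comm]

/-- The state equation in integrated form: `∫ₛᵗ Y ∈ D(A)` and
`A ∫ₛᵗ Y = Y(t) - x - ∫ₛᵗ B z - (w(t), 0)`. -/
theorem graphA_integral_trajectory (hρ : Continuous ρ) {T : ℝ}
    (hres : ∀ t ∈ Icc 0 T, ρ t = M.kernel t + ∫ u in (0 : ℝ)..t, ρ u * M.kernel (t - u))
    (hw : Continuous w) (hz : LocallyIntegrable z) {t : ℝ} (hst : s ≤ t) (htT : t - s ≤ T) :
    M.GraphA (∫ u in s..t, M.trajectory ρ s x w z u)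
      (M.trajectory ρ s x w z t - x - (∫ u in s..t, z u) • M.B 1
        - WithLp.toLp 2 (w t, 0)) := by
  have hr := M.r_pos.le
  have hy := M.continuous_present s x hρ hw hz
  have hY := M.continuous_trajectory s x hρ hw hz
  have hF := M.continuous_forcing s x hw hz
  set y := M.present ρ s x w z with hydef
  set e := WithLp.prodContinuousLinearEquiv 2 ℝ ℝ (HistorySpace M.r)
  have hfst : (∫ u in s..t, M.trajectory ρ s x w z u).fst = ∫ u in s..t, y u :=
    (((ContinuousLinearMap.fst ℝ ℝ (HistorySpace M.r)).comp
      (e : M.X →L[ℝ] ℝ × HistorySpace M.r)).intervalIntegral_comp_comm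
        (hY.intervalIntegrable s t)).symm
  have hsnd : (∫ u in s..t, M.trajectory ρ s x w z u).snd
      = ∫ u in s..t, (shift (u - s) x.snd + causalConv s (fun τ => shift τ M.a₁) y u
          + causalConv s (fun τ => shift τ M.b₁) z u) :=
    (((ContinuousLinearMap.snd ℝ ℝ (HistorySpace M.r)).comp
      (e : M.X →L[ℝ] ℝ × HistorySpace M.r)).intervalIntegral_comp_comm
        (hY.intervalIntegrable s t)).symm
  have h1 : Continuous fun u => shift (u - s) x.snd :=
    (continuous_shift x.snd).comp (continuous_id.sub (continuous_const (y := s)))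
  have h2 := continuous_causalConv s (continuous_shift M.a₁) hy.locallyIntegrable
  have h3 := continuous_causalConv s (continuous_shift M.b₁) hz
  have h12 : Continuous fun u => shift (u - s) x.snd + causalConv s (fun τ => shift τ M.a₁) y u :=
    h1.add h2
  rw [intervalIntegral.integral_add (h12.intervalIntegrable _ _)
    (h3.intervalIntegrable _ _), intervalIntegral.integral_add (h1.intervalIntegrable _ _)
    (h2.intervalIntegrable _ _), intervalIntegral.integral_comp_sub_right (fun v => shift v x.snd),
    sub_self, integral_shift hr x.snd (by linarith),
    integral_causalConv_shift hr M.a₁ hy.locallyIntegrable hst,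
    integral_causalConv_shift hr M.b₁ hz hst, ← primitive_add, ← primitive_add] at hsnd
  refine (M.graphA_iff _ _).2 ⟨_, hsnd, ?_⟩
  rw [inner_add_right, inner_add_right, inner_oneHist_sub_causalConv M.a₁ hy.locallyIntegrable hst,
    inner_oneHist_sub_causalConv M.b₁ hz hst, hfst]
  -- The Volterra equation is exactly the first component of the claim; the second holds by the form
  -- of the primitive in `hsnd`.
  have hvolt : y t = M.forcing s x w z t + causalConv s M.kernel y t :=
    volterra_solution M.continuous_kernel hρ hF hres hst htT
  have hk : causalConv s M.kernel y t
      = M.a₀ * (∫ u in s..t, y u) + causalConv s (outflow M.a₁) y t :=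
    causalConv_const_add hy.locallyIntegrable (continuous_outflow M.a₁) M.a₀ hst
  have hb : causalConv s (fun τ => M.b₀ + outflow M.b₁ τ) z t
      = M.b₀ * (∫ u in s..t, z u) + causalConv s (outflow M.b₁) z t :=
    causalConv_const_add hz (continuous_outflow M.b₁) M.b₀ hst
  rw [hk, forcing, hb] at hvolt
  apply (WithLp.ofLp_injective 2)
  refine Prod.ext ?_ ?_
  · simp only [WithLp.ofLp_sub, Prod.fst_sub, WithLp.ofLp_smul, Prod.smul_fst, B, mul_one,
      smul_eq_mul]
    rw [show (M.trajectory ρ s x w z t).ofLp.1 = y t from rfl, hvolt, outflow,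
      show x.ofLp.1 = x.fst from rfl]
    ring
  · simp only [WithLp.ofLp_sub, Prod.snd_sub, WithLp.ofLp_smul, Prod.smul_snd, B, one_smul]
    rw [show (M.trajectory ρ s x w z t).ofLp.2 = shift (t - s) x.snd
      + causalConv s (fun τ => shift τ M.a₁) y t
      + causalConv s (fun τ => shift τ M.b₁) z t from rfl]
    rw [sub_zero, show x.ofLp.2 = x.snd from rfl]
    abel

/-- The state equation in weak form. -/
theorem weak_trajectory (hρ : Continuous ρ) {T : ℝ}
    (hres : ∀ t ∈ Icc 0 T, ρ t = M.kernel t + ∫ u in (0 : ℝ)..t, ρ u * M.kernel (t - u))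
    (hw : Continuous w) (hz : LocallyIntegrable z) {t : ℝ} (hst : s ≤ t) (htT : t - s ≤ T)
    {ζ η : M.X} (hζ : M.GraphAdjoint ζ η) :
    inner ℝ (M.trajectory ρ s x w z t) ζ = inner ℝ x ζ
      + (∫ u in s..t, (inner ℝ (M.trajectory ρ s x w z u) η + inner ℝ (M.B (z u)) ζ))
      + inner ℝ (WithLp.toLp 2 (w t, 0) : M.X) ζ := by
  have hzI : IntervalIntegrable z volume s t :=
    (hz.integrableOn_isCompact isCompact_uIcc).intervalIntegrable
  have hY := M.continuous_trajectory s x hρ hw hz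
  have h := hζ _ _ (M.graphA_integral_trajectory s x hρ hres hw hz hst htT)
  have e1 : inner ℝ (∫ u in s..t, M.trajectory ρ s x w z u) η
      = ∫ u in s..t, inner ℝ (M.trajectory ρ s x w z u) η := by
    rw [real_inner_comm]
    have := (innerSL ℝ η).intervalIntegral_comp_comm (hY.intervalIntegrable (μ := volume) s t)
    simp only [innerSL_apply_apply] at this
    rw [← this]
    simp only [real_inner_comm]
  have e2 : ∫ u in s..t, inner ℝ (M.B (z u)) ζ = (∫ u in s..t, z u) * inner ℝ (M.B 1) ζ := by
    rw [← intervalIntegral.integral_mul_const]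
    refine intervalIntegral.integral_congr fun u _ => ?_
    rw [M.B_eq_smul, real_inner_smul_left]
  have hBI : IntervalIntegrable (fun u => inner ℝ (M.B (z u)) ζ) volume s t := by
    refine (hzI.mul_const (inner ℝ (M.B 1) ζ)).congr fun u _ => ?_
    rw [M.B_eq_smul (z u), real_inner_smul_left]
  rw [intervalIntegral.integral_add
    ((hY.inner continuous_const).intervalIntegrable _ _) hBI, e2, ← e1, ← h]
  simp only [inner_sub_left, real_inner_smul_left]
  ring

/-- Linear growth of the present value in the initial state and the noise path. -/
theorem one_add_abs_present_le {T R Z : ℝ} (hT : 0 ≤ T) (hZ : 0 ≤ Z)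
    (hR : ∀ t ∈ Icc 0 T, |ρ t| ≤ R) (hw : Continuous w) (hz : LocallyIntegrable z)
    (hzZ : ∀ u, |z u| ≤ Z) {t : ℝ} (hst : s ≤ t) (htT : t - s ≤ T) :
    1 + |M.present ρ s x w z t| ≤
      ((1 + 2 * ‖oneHist M.r‖ + (M.b₀ + 2 * ‖oneHist M.r‖ * ‖M.b₁‖) * (Z * T)) * (1 + R * T) + 1 + R)
        * (1 + ‖x‖) * (1 + |w t| + ∫ u in s..t, |w u|) := by
  set c := ‖oneHist M.r‖ with hc
  have hc0 : 0 ≤ c := norm_nonneg _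
  set D := M.b₀ + 2 * c * ‖M.b₁‖ with hD
  have hD0 : 0 ≤ D := by have := M.b₀_nonneg; positivity
  -- The three terms account for `x₀`, the outflow of `x₁` and the control; the noise is kept apart.
  set A := 1 + 2 * c + D * (Z * T) with hA
  have hA1 : 1 ≤ A := by
    have : 0 ≤ D * (Z * T) := by positivity
    linarith
  have hR0 : 0 ≤ R := (abs_nonneg _).trans (hR 0 ⟨le_rfl, hT⟩)
  have hF := M.continuous_forcing s x hw hz
  have hx1 : |x.fst| ≤ ‖x‖ := WithLp.norm_fst_le _ x
  have hx2 : ‖x.snd‖ ≤ ‖x‖ := WithLp.norm_snd_le _ x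
  have hforc : ∀ u ∈ Icc s t, |M.forcing s x w z u| ≤ A * (1 + ‖x‖) + |w u| := by
    intro u hu
    have h1 := abs_outflow_le x.snd (u - s)
    have h2 : |causalConv s (fun τ => M.b₀ + outflow M.b₁ τ) z u| ≤ D * (Z * T) := by
      refine (norm_causalConv_le hu.1 (C := D) (fun v _ => ?_) hz).trans ?_
      · exact (abs_add_le _ _).trans (add_le_add (abs_of_nonneg M.b₀_nonneg).le (abs_outflow_le _ _))
      · refine mul_le_mul_of_nonneg_left ?_ hD0
        have h3 : ∫ v in s..u, |z v| ≤ ∫ _ in s..u, Z :=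
          intervalIntegral.integral_mono_on hu.1
            (hz.integrableOn_isCompact isCompact_uIcc).intervalIntegrable.abs
            intervalIntegrable_const (fun v _ => hzZ v)
        rw [intervalIntegral.integral_const, smul_eq_mul] at h3
        nlinarith [hu.2]
    have h4 : |M.forcing s x w z u| ≤ |x.fst| + |outflow x.snd (u - s)| + |w u|
        + |causalConv s (fun τ => M.b₀ + outflow M.b₁ τ) z u| :=
      (abs_add_le _ _).trans (add_le_add_left ((abs_add_le _ _).trans
        (add_le_add_left (abs_add_le _ _) _)) _)
    have h5 : 0 ≤ D * (Z * T) := by positivity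
    have h6 : 2 * c * ‖x.snd‖ ≤ 2 * c * ‖x‖ := by gcongr
    nlinarith [norm_nonneg x, mul_nonneg h5 (norm_nonneg x)]
  have hint : 0 ≤ ∫ u in s..t, |w u| :=
    intervalIntegral.integral_nonneg hst fun _ _ => abs_nonneg _
  have hconv : |causalConv s ρ (M.forcing s x w z) t|
      ≤ R * (A * (1 + ‖x‖) * T + ∫ u in s..t, |w u|) := by
    refine (norm_causalConv_le hst (C := R) (fun u hu => hR _ ⟨by linarith [hu.2],
      by linarith [hu.1]⟩) hF.locallyIntegrable).trans (mul_le_mul_of_nonneg_left ?_ hR0)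
    have h3 : ∫ v in s..t, |M.forcing s x w z v| ≤ ∫ v in s..t, (A * (1 + ‖x‖) + |w v|) :=
      intervalIntegral.integral_mono_on hst (Continuous.intervalIntegrable (by fun_prop) _ _)
        (Continuous.intervalIntegrable (by fun_prop) _ _) hforc
    rw [intervalIntegral.integral_add intervalIntegrable_const
      (Continuous.intervalIntegrable (by fun_prop) _ _), intervalIntegral.integral_const,
      smul_eq_mul] at h3
    have h5 : (t - s) * (A * (1 + ‖x‖)) ≤ A * (1 + ‖x‖) * T := by
      rw [mul_comm]; gcongr
    linarith
  have hpres : |M.present ρ s x w z t| ≤ A * (1 + ‖x‖) + |w t|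
      + R * (A * (1 + ‖x‖) * T + ∫ u in s..t, |w u|) :=
    (abs_add_le _ _).trans (add_le_add (hforc t ⟨hst, le_rfl⟩) hconv)
  set I := ∫ u in s..t, |w u|
  set X := 1 + ‖x‖
  have hX : 1 ≤ X := by simp [X]
  have hw0 := abs_nonneg (w t)
  have hRT : 0 ≤ R * T := by positivity
  have hS : 1 ≤ 1 + |w t| + I := by linarith
  -- Both factors of the target product are at least `1`, so it absorbs the initial state and the
  -- noise separately.
  have k1 : A * (1 + R * T) * X ≤ A * (1 + R * T) * X * (1 + |w t| + I) :=
    le_mul_of_one_le_right (by positivity) hS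
  have k2 : 1 + |w t| + I ≤ X * (1 + |w t| + I) := le_mul_of_one_le_left (by linarith) hX
  have k3 : R * I ≤ R * (X * (1 + |w t| + I)) := by gcongr; linarith
  nlinarith

end DelayModel

/-! ### Uniqueness of the present value -/

section Uniqueness

open Filter Topology

theorem norm_expHist_le {r l : ℝ} (hl : 0 ≤ l) : ‖expHist r l‖ ≤ ‖oneHist r‖ := by
  refine Lp.norm_le_norm_of_ae_le ?_
  filter_upwards [ofContinuous_ae_eq r (e := fun ξ => Real.exp (l * ξ)) (by fun_prop),
    ofContinuous_ae_eq r (e := fun _ => 1) continuous_const,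
    ae_restrict_mem measurableSet_Icc] with ξ h1 h2 hξ
  rw [expHist, oneHist, h1, h2, norm_one, Real.norm_of_nonneg (Real.exp_nonneg _)]
  exact Real.exp_le_one_iff.2 (mul_nonpos_of_nonneg_of_nonpos hl hξ.2)

/-- Dominated convergence, as `e^{nξ} → 0` for `ξ < 0`. It settles the case `s = T`, where there is
no time interval for the moment argument. -/
theorem tendsto_inner_expHist {r : ℝ} (hr : 0 ≤ r) (g : HistorySpace r) :
    Tendsto (fun n : ℕ => inner ℝ g (expHist r n)) atTop (𝓝 0) := by
  have hle : -r ≤ 0 := by linarith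
  have hg := intervalIntegrable_history g (neg_left_mem_history hr) (zero_mem_history hr)
  have e : ∀ n : ℕ, inner ℝ g (expHist r n) = ∫ ξ in (-r)..0, Real.exp (n * ξ) * g ξ := by
    intro n
    rw [real_inner_comm, expHist, inner_ofContinuous, setIntegral_history_eq_intervalIntegral hr]
  simp_rw [e]
  suffices h : Tendsto (fun n : ℕ => ∫ ξ in (-r)..0, Real.exp (n * ξ) * g ξ) atTop
      (𝓝 (∫ _ in (-r)..0, (0 : ℝ))) by simpa using h
  refine intervalIntegral.tendsto_integral_filter_of_dominated_convergence (fun ξ => ‖g ξ‖)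
    ?_ ?_ hg.norm ?_
  · filter_upwards with n
    rw [uIoc_of_le hle]
    exact (Continuous.aestronglyMeasurable (by fun_prop)).mul
      ((intervalIntegrable_iff_integrableOn_Ioc_of_le hle).1 hg).aestronglyMeasurable
  · filter_upwards with n
    filter_upwards with ξ hξ
    rw [uIoc_of_le hle] at hξ
    rw [norm_mul, Real.norm_of_nonneg (Real.exp_nonneg _)]
    exact mul_le_of_le_one_left (norm_nonneg _) (Real.exp_le_one_iff.2
      (mul_nonpos_of_nonneg_of_nonpos n.cast_nonneg hξ.2))
  · have : ∀ᵐ ξ : ℝ, ξ ≠ 0 := by simp [ae_iff]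
    filter_upwards [this] with ξ hξ0 hξ
    rw [uIoc_of_le hle] at hξ
    have h1 : Tendsto (fun n : ℕ => (n : ℝ) * ξ) atTop atBot :=
      tendsto_natCast_atTop_atTop.atTop_mul_const_of_neg (lt_of_le_of_ne hξ.2 hξ0)
    simpa using (Real.tendsto_exp_atBot.comp h1).mul_const (g ξ)

namespace DelayModel

variable (M : DelayModel)

/-- The vector `(1, e^{λξ})` of `D(A*)`. -/
def expTest (l : ℝ) : M.X := WithLp.toLp 2 (1, expHist M.r l)

/-- The image of `expTest` under `A*`. -/
def adjointExpTest (l : ℝ) : M.X :=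
  WithLp.toLp 2 (M.a₀ + inner ℝ M.a₁ (expHist M.r l), l • expHist M.r l)

theorem inner_expTest (v : M.X) (l : ℝ) :
    inner ℝ v (M.expTest l) = v.fst + inner ℝ v.snd (expHist M.r l) := by
  rw [expTest, inner_toLp_right, mul_one]

/-- The exponential test vector is an eigenvector of `A*` up to an error in the first component, so
the tested equation is a scalar ODE driven by the present value. -/
theorem inner_adjointExpTest (v : M.X) (l : ℝ) : inner ℝ v (M.adjointExpTest l)
    = l * inner ℝ v (M.expTest l) + (M.a₀ + inner ℝ M.a₁ (expHist M.r l) - l) * v.fst := by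
  rw [adjointExpTest, inner_toLp_right, inner_expTest, real_inner_smul_right]
  ring

/-- A continuous solution of the homogeneous equation, tested against the exponentials only,
has vanishing present value. -/
theorem fst_eq_zero_of_expTest {D : ℝ → M.X} {s T : ℝ} (hsT : s ≤ T)
    (hD : ContinuousOn D (Icc s T))
    (h : ∀ n : ℕ, ∀ t ∈ Icc s T,
      inner ℝ (D t) (M.expTest n) = ∫ u in s..t, inner ℝ (D u) (M.adjointExpTest n)) :
    (D T).fst = 0 := by
  have hTmem : T ∈ Icc s T := ⟨hsT, le_rfl⟩
  rcases hsT.eq_or_lt with rfl | hlt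
  · have h1 : ∀ n : ℕ, (D s).fst = -inner ℝ (D s).snd (expHist M.r n) := by
      intro n
      have := h n s hTmem
      rw [intervalIntegral.integral_same, inner_expTest] at this
      linarith
    have h2 := (tendsto_inner_expHist M.r_pos.le (D s).snd).neg
    simp_rw [← h1, neg_zero] at h2
    exact tendsto_nhds_unique tendsto_const_nhds h2
  have hfst : ContinuousOn (fun u => (D u).fst) (Icc s T) :=
    (WithLp.fstL 2 ℝ ℝ (HistorySpace M.r)).continuous.comp_continuousOn hD
  -- Variation of constants: the integrating factor `e^{n(T-t)}` removes the eigenvalue term.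
  have hdual : ∀ n : ℕ, inner ℝ (D T) (M.expTest n)
      = (M.a₀ + inner ℝ M.a₁ (expHist M.r n) - n)
        * ∫ u in s..T, Real.exp (n * (T - u)) * (D u).fst := by
    intro n
    have hη : ContinuousOn (fun u => inner ℝ (D u) (M.adjointExpTest n)) (Icc s T) :=
      hD.inner continuousOn_const
    have hζ : ContinuousOn (fun u => inner ℝ (D u) (M.expTest n)) (Icc s T) :=
      hD.inner continuousOn_const
    have hderiv : ∀ t ∈ Ioo s T, HasDerivAt (fun t => Real.exp (n * (T - t))
        * inner ℝ (D t) (M.expTest n))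
        ((M.a₀ + inner ℝ M.a₁ (expHist M.r n) - n) * (Real.exp (n * (T - t)) * (D t).fst)) t := by
      intro t ht
      have hd1 : HasDerivAt (fun t => ∫ u in s..t, inner ℝ (D u) (M.adjointExpTest n))
          (inner ℝ (D t) (M.adjointExpTest n)) t :=
        intervalIntegral.integral_hasDerivAt_right
          ((hη.mono (Icc_subset_Icc_right ht.2.le)).intervalIntegrable_of_Icc ht.1.le)
          ((hη.mono Ioo_subset_Icc_self).stronglyMeasurableAtFilter isOpen_Ioo t ht)
          (hη.continuousAt (Icc_mem_nhds ht.1 ht.2))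
      have hd2 : HasDerivAt (fun t => inner ℝ (D t) (M.expTest n))
          (inner ℝ (D t) (M.adjointExpTest n)) t := by
        refine hd1.congr_of_eventuallyEq ?_
        filter_upwards [Icc_mem_nhds ht.1 ht.2] with u hu using h n u hu
      have hd3 : HasDerivAt (fun t => Real.exp (n * (T - t)))
          (Real.exp (n * (T - t)) * (n * -1)) t :=
        (((hasDerivAt_id t).const_sub T).const_mul (n : ℝ)).exp
      refine (hd3.mul hd2).congr_deriv ?_
      rw [inner_adjointExpTest]
      ring
    have hFTC := intervalIntegral.integral_eq_sub_of_hasDerivAt_of_le hsT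
      (ContinuousOn.mul (by fun_prop) hζ) hderiv
      (ContinuousOn.intervalIntegrable_of_Icc hsT
        (continuousOn_const.mul (ContinuousOn.mul (by fun_prop) hfst)))
    simp only [Pi.mul_apply] at hFTC
    rw [intervalIntegral.integral_const_mul, h n s ⟨le_rfl, hsT⟩] at hFTC
    simpa using hFTC.symm
  -- For `n ≥ n₀` the prefactor in `hdual` has modulus at least `1`, so the moments are bounded by
  -- the left side, which is bounded in `n`.
  obtain ⟨n₀, hn₀⟩ := exists_nat_ge (1 + |M.a₀| + ‖M.a₁‖ * ‖oneHist M.r‖)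
  have hq : ContinuousOn (fun v => (D (T - v)).fst) (Icc 0 (T - s)) :=
    hfst.comp (by fun_prop) fun v hv => ⟨by linarith [hv.2], by linarith [hv.1]⟩
  have := eq_zero_of_bounded_exp_moments (L := T - s) hq (n₀ := n₀)
    (M := |(D T).fst| + ‖(D T).snd‖ * ‖oneHist M.r‖) ?_ (by linarith) 0 ⟨le_rfl, by linarith⟩
  · simpa using this
  intro n hn
  have e1 : ∫ v in (0 : ℝ)..(T - s), Real.exp (n * v) * (D (T - v)).fst
      = ∫ u in s..T, Real.exp (n * (T - u)) * (D u).fst := by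
    have := intervalIntegral.integral_comp_sub_left (a := s) (b := T)
      (fun v => Real.exp (n * v) * (D (T - v)).fst) T
    simpa using this.symm
  rw [e1]
  have hle := norm_expHist_le (r := M.r) (l := n) n.cast_nonneg
  have hb : |inner ℝ (D T) (M.expTest n)| ≤ |(D T).fst| + ‖(D T).snd‖ * ‖oneHist M.r‖ := by
    rw [inner_expTest]
    exact (abs_add_le _ _).trans (add_le_add_right ((abs_real_inner_le_norm _ _).trans
      (mul_le_mul_of_nonneg_left hle (norm_nonneg _))) _)
  rw [hdual, abs_mul] at hb
  refine le_trans (le_mul_of_one_le_left (abs_nonneg _) ?_) hb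
  have h1 := (abs_real_inner_le_norm M.a₁ (expHist M.r n)).trans
    (mul_le_mul_of_nonneg_left hle (norm_nonneg _))
  have h2 : (n₀ : ℝ) ≤ n := by exact_mod_cast hn
  rw [abs_sub_comm]
  refine le_trans ?_ (le_abs_self _)
  linarith [le_abs_self M.a₀, le_abs_self (inner ℝ M.a₁ (expHist M.r n))]

end DelayModel

end Uniqueness

/-! ### Noise paths -/

section Noise

variable {Ω : Type*}

/-- The noise `σ (B(t) - B(s))`, `t ≥ s`, as a function of real time. -/
def noisePath (σ : ℝ) (B : ℝ≥0 → Ω → ℝ) (s : ℝ≥0) (ω : Ω) (t : ℝ) : ℝ :=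
  σ * (B t.toNNReal ω - B (min s t.toNNReal) ω)

theorem continuous_noisePath (σ : ℝ) {B : ℝ≥0 → Ω → ℝ} {ω : Ω} (hB : Continuous fun t => B t ω)
    (s : ℝ≥0) : Continuous (noisePath σ B s ω) := by
  have h1 : Continuous fun t : ℝ => B t.toNNReal ω := hB.comp continuous_real_toNNReal
  have h2 : Continuous fun t : ℝ => B (min s t.toNNReal) ω :=
    hB.comp (continuous_const.min continuous_real_toNNReal)
  exact continuous_const.mul (h1.sub h2)

end Noise

/-! ### Measurability of the state process and the weak equation -/

section Dynamics

variable {Ω : Type*} [mΩ : MeasurableSpace Ω]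

/-- The path of a control process, as a function of real time. -/
def controlPath (z : ℝ≥0 → Ω → ℝ≥0) (ω : Ω) (u : ℝ) : ℝ := z u.toNNReal ω

/-- Progressive measurability controls the path only on each `[0, n]`; the paths frozen after time
`n` converge to the whole path. -/
theorem measurable_controlPath {ℱ : Filtration ℝ≥0 mΩ} {z : ℝ≥0 → Ω → ℝ≥0}
    (hz : IsStronglyProgressive ℱ z) (ω : Ω) : Measurable (controlPath z ω) := by
  suffices h : Measurable fun t : ℝ≥0 => z t ω from
    (measurable_coe_nnreal_real.comp h).comp measurable_real_toNNReal
  have hn : ∀ n : ℕ, Measurable fun t : ℝ≥0 => z (min t n) ω := by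
    intro n
    have h1 := (hz n).measurable
    have h2 : @Measurable _ _ _ (Subtype.instMeasurableSpace.prod (ℱ n))
        fun t : ℝ≥0 => ((⟨min t n, mem_Iic.2 (min_le_right _ _)⟩ : Iic (n : ℝ≥0)), ω) :=
      @Measurable.prodMk _ _ _ _ _ (ℱ n) _ _
        ((measurable_id.min measurable_const).subtype_mk) measurable_const
    exact h1.comp h2
  refine measurable_of_tendsto_metrizable hn (tendsto_pi_nhds.2 fun t => ?_)
  refine tendsto_const_nhds.congr' ?_
  obtain ⟨n₀, hn₀⟩ := exists_nat_ge t
  filter_upwards [Filter.eventually_ge_atTop n₀] with n hn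
  rw [min_eq_left (hn₀.trans (by exact_mod_cast hn))]

theorem DelayModel.IsAdmissible.abs_controlPath_le {M : DelayModel} {ℱ : Filtration ℝ≥0 mΩ}
    {z : ℝ≥0 → Ω → ℝ≥0} (hz : M.IsAdmissible ℱ z) (ω : Ω) (u : ℝ) :
    |controlPath z ω u| ≤ M.uMax := by
  rw [controlPath, abs_of_nonneg (NNReal.coe_nonneg _)]
  exact_mod_cast (hz.2 u.toNNReal ω).2

theorem DelayModel.IsAdmissible.locallyIntegrable_controlPath {M : DelayModel}
    {ℱ : Filtration ℝ≥0 mΩ} {z : ℝ≥0 → Ω → ℝ≥0} (hz : M.IsAdmissible ℱ z) (ω : Ω) :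
    LocallyIntegrable (controlPath z ω) := by
  refine (locallyIntegrable_const (M.uMax : ℝ)).mono
    (measurable_controlPath hz.1 ω).aestronglyMeasurable (ae_of_all _ fun u => ?_)
  rw [Real.norm_eq_abs, Real.norm_of_nonneg (NNReal.coe_nonneg _)]
  exact hz.abs_controlPath_le ω u

/-- Only `Z` up to time `t` enters. Freezing its time at `min u t` makes the integrand jointly
measurable for `ℱ t` on all of `ℝ × Ω`, and integrating out `u` preserves this. -/
theorem stronglyMeasurable_causalConv {E : Type*} [NormedAddCommGroup E] [NormedSpace ℝ E]
    {ℱ : Filtration ℝ≥0 mΩ} {Z : ℝ → Ω → ℝ}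
    (hZ : IsStronglyProgressive ℱ fun t : ℝ≥0 => Z t) {c : ℝ → E} (hc : Continuous c)
    (s t : ℝ≥0) :
    StronglyMeasurable[ℱ t] fun ω => causalConv (s : ℝ) c (fun u => Z u ω) t := by
  rcases lt_or_ge t s with hts | hst
  · have : (fun ω => causalConv (s : ℝ) c (fun u => Z u ω) t) = fun _ => 0 := by
      ext ω
      rw [causalConv, max_eq_left (by exact_mod_cast hts.le), intervalIntegral.integral_same]
    rw [this]
    exact stronglyMeasurable_const
  have hst' : (s : ℝ) ≤ t := by exact_mod_cast hst
  have e : (fun ω => causalConv (s : ℝ) c (fun u => Z u ω) t)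
      = fun ω => ∫ u in Ioc (s : ℝ) t, Z (min u.toNNReal t : ℝ≥0) ω • c (t - u) := by
    ext ω
    rw [causalConv_of_le hst', intervalIntegral.integral_of_le hst']
    refine setIntegral_congr_fun measurableSet_Ioc fun u hu => ?_
    have hu0 : 0 ≤ u := s.coe_nonneg.trans hu.1.le
    have : ((min u.toNNReal t : ℝ≥0) : ℝ) = u := by
      rw [NNReal.coe_min, Real.coe_toNNReal _ hu0, min_eq_left hu.2]
    simp only [this]
  rw [e]
  have h1 : @Measurable _ _ (MeasurableSpace.prod _ (ℱ t)) (Subtype.instMeasurableSpace.prod (ℱ t))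
      fun p : ℝ × Ω => ((⟨min p.1.toNNReal t, mem_Iic.2 (min_le_right _ _)⟩ : Iic t), p.2) :=
    @Measurable.prodMk _ (MeasurableSpace.prod _ (ℱ t)) _ _ _ (ℱ t) _ _
      (((measurable_real_toNNReal.comp (@measurable_fst _ _ _ (ℱ t))).min
        measurable_const).subtype_mk)
      (@measurable_snd _ _ _ (ℱ t))
  have h2 : StronglyMeasurable[MeasurableSpace.prod _ (ℱ t)]
      fun p : ℝ × Ω => Z (min p.1.toNNReal t : ℝ≥0) p.2 :=
    (hZ t).comp_measurable h1
  have h3 : StronglyMeasurable[MeasurableSpace.prod _ (ℱ t)] fun p : ℝ × Ω => c (t - p.1) :=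
    (hc.comp (continuous_const.sub continuous_id)).stronglyMeasurable.comp_measurable
      (@measurable_fst _ _ _ (ℱ t))
  exact @StronglyMeasurable.integral_prod_left' _ _ _ _ (ℱ t) _ _ _ _ _ (h2.smul h3)

namespace DelayModel

variable (M : DelayModel)

/-- The state process driven by the continuous noise process `B` under the control `z`. -/
def stateDynamics (ρ : ℝ → ℝ) (B : ℝ≥0 → Ω → ℝ) (s : ℝ≥0) (x : M.X) (z : ℝ≥0 → Ω → ℝ≥0)
    (t : ℝ≥0) (ω : Ω) : M.X :=
  M.trajectory ρ s x (noisePath M.σ B s ω) (controlPath z ω) t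

variable {M} {ρ : ℝ → ℝ} {ℱ : Filtration ℝ≥0 mΩ} {B : ℝ≥0 → Ω → ℝ} {z : ℝ≥0 → Ω → ℝ≥0}

/-- Each convolution needs a progressive integrand; path continuity upgrades adaptedness of the
forcing, then of the present value, before the next convolution. -/
theorem stronglyAdapted_stateDynamics (hρ : Continuous ρ) (hB : StronglyAdapted ℱ B)
    (hBc : ∀ ω, Continuous fun t => B t ω) (s : ℝ≥0) (x : M.X) (hz : M.IsAdmissible ℱ z) :
    StronglyAdapted ℱ (M.stateDynamics ρ B s x z) := by
  have hzp : IsStronglyProgressive ℱ fun t : ℝ≥0 => fun ω => controlPath z ω t := by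
    intro i
    have := (hz.1 i).measurable
    simp only [controlPath, Real.toNNReal_coe]
    exact (measurable_coe_nnreal_real.comp this).stronglyMeasurable
  have hw : ∀ t : ℝ≥0, StronglyMeasurable[ℱ t] fun ω => noisePath M.σ B s ω t := by
    intro t
    simp only [noisePath, Real.toNNReal_coe]
    -- Thanks to `min s t` the noise path does not look ahead to time `s` when `t < s`.
    exact ((hB t).sub ((hB (min s t)).mono (ℱ.mono (min_le_right _ _)))).const_mul _
  have hF : ∀ t : ℝ≥0, StronglyMeasurable[ℱ t] fun ω =>
      M.forcing s x (noisePath M.σ B s ω) (controlPath z ω) t := by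
    intro t
    exact (stronglyMeasurable_const.add (hw t)).add (stronglyMeasurable_causalConv hzp
      (continuous_const.add (continuous_outflow M.b₁)) s t)
  have hFp := StronglyAdapted.isStronglyProgressive_of_continuous
    (u := fun (t : ℝ≥0) ω => M.forcing s x (noisePath M.σ B s ω) (controlPath z ω) t) hF
    fun ω => (M.continuous_forcing s x (continuous_noisePath M.σ (hBc ω) s)
      (hz.locallyIntegrable_controlPath ω)).comp NNReal.continuous_coe
  have hy : ∀ t : ℝ≥0, StronglyMeasurable[ℱ t] fun ω =>
      M.present ρ s x (noisePath M.σ B s ω) (controlPath z ω) t := by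
    intro t
    exact (hF t).add (stronglyMeasurable_causalConv hFp hρ s t)
  have hyp := StronglyAdapted.isStronglyProgressive_of_continuous
    (u := fun (t : ℝ≥0) ω => M.present ρ s x (noisePath M.σ B s ω) (controlPath z ω) t) hy
    fun ω => (M.continuous_present s x hρ (continuous_noisePath M.σ (hBc ω) s)
      (hz.locallyIntegrable_controlPath ω)).comp NNReal.continuous_coe
  intro t
  exact (WithLp.prod_continuous_toLp 2 ℝ (HistorySpace M.r)).comp_stronglyMeasurable
    ((hy t).prodMk ((stronglyMeasurable_const.add
      (stronglyMeasurable_causalConv hyp (continuous_shift M.a₁) s t)).add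
      (stronglyMeasurable_causalConv hzp (continuous_shift M.b₁) s t)))

/-- The equation holds on every path of `B`, hence for `W` off one null set serving all `ζ` and `t`.
-/
theorem isWeakSolution_stateDynamics {P : Measure Ω} {W : ℝ≥0 → Ω → ℝ} {T s : ℝ≥0}
    (hρ : Continuous ρ)
    (hres : ∀ t ∈ Icc 0 (T : ℝ),
      ρ t = M.kernel t + ∫ u in (0 : ℝ)..t, ρ u * M.kernel (t - u))
    (hB : StronglyAdapted ℱ B) (hBc : ∀ ω, Continuous fun t => B t ω)
    (hBW : ∀ᵐ ω ∂P, ∀ t, B t ω = W t ω) (x : M.X) (hz : M.IsAdmissible ℱ z) :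
    M.IsWeakSolution P ℱ W T s x z (M.stateDynamics ρ B s x z) where
  adapted t _ := stronglyAdapted_stateDynamics hρ hB hBc s x hz t
  continuous_paths := ae_of_all _ fun ω =>
    ((M.continuous_trajectory s x hρ (continuous_noisePath M.σ (hBc ω) s)
      (hz.locallyIntegrable_controlPath ω)).comp NNReal.continuous_coe).continuousOn
  weak_eq ζ η hζ := by
    filter_upwards [hBW] with ω hω t ht
    have hst : (s : ℝ) ≤ t := by exact_mod_cast ht.1
    have htT : (t : ℝ) - s ≤ T := by
      have : (t : ℝ) ≤ T := by exact_mod_cast ht.2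
      linarith [s.coe_nonneg]
    have h := M.weak_trajectory s x hρ hres (continuous_noisePath M.σ (hBc ω) s)
      (hz.locallyIntegrable_controlPath ω) hst htT hζ
    have hG : (WithLp.toLp 2 (noisePath M.σ B s ω t, 0) : M.X) = M.G (W t ω - W s ω) := by
      rw [noisePath, G, Real.toNNReal_coe, min_eq_left ht.1, hω, hω]
    rw [← hG]
    refine h.trans ?_
    congr 2
    refine intervalIntegral.integral_congr fun u hu => ?_
    rw [uIcc_of_le hst] at hu
    simp only [stateDynamics, controlPath, Real.coe_toNNReal _ (s.coe_nonneg.trans hu.1)]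

/-- The present value of the state is determined by the state equation. -/
theorem IsWeakSolution.fst_ae_eq {P : Measure Ω} {W : ℝ≥0 → Ω → ℝ} {T s : ℝ≥0} (hsT : s ≤ T)
    {x : M.X} (hz : M.IsAdmissible ℱ z) {Y Y' : ℝ≥0 → Ω → M.X}
    (hY : M.IsWeakSolution P ℱ W T s x z Y) (hY' : M.IsWeakSolution P ℱ W T s x z Y') :
    ∀ᵐ ω ∂P, (Y T ω).fst = (Y' T ω).fst := by
  have hsT' : (s : ℝ) ≤ T := by exact_mod_cast hsT
  -- The exceptional set depends on the test vector; countably many exponents leave a common null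
  -- set.
  have hYe := ae_all_iff.2 fun n : ℕ => hY.weak_eq _ _ (M.graphAdjoint_exp n)
  have hYe' := ae_all_iff.2 fun n : ℕ => hY'.weak_eq _ _ (M.graphAdjoint_exp n)
  filter_upwards [hYe, hYe', hY.continuous_paths, hY'.continuous_paths] with ω h h' hc hc'
  have hmaps : MapsTo Real.toNNReal (Icc (s : ℝ) T) (Icc s T) := fun u hu =>
    ⟨NNReal.le_toNNReal_of_coe_le hu.1, Real.toNNReal_le_iff_le_coe.2 hu.2⟩
  have c1 : ContinuousOn (fun u : ℝ => Y u.toNNReal ω) (Icc (s : ℝ) T) :=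
    hc.comp continuous_real_toNNReal.continuousOn hmaps
  have c2 : ContinuousOn (fun u : ℝ => Y' u.toNNReal ω) (Icc (s : ℝ) T) :=
    hc'.comp continuous_real_toNNReal.continuousOn hmaps
  -- Initial state, control and noise cancel in the difference, which solves the homogeneous
  -- equation.
  have key := M.fst_eq_zero_of_expTest (D := fun u : ℝ => Y u.toNNReal ω - Y' u.toNNReal ω) hsT'
    (c1.sub c2) ?_
  · simp only [Real.toNNReal_coe, WithLp.sub_fst] at key
    exact sub_eq_zero.1 key
  intro n t ht
  have ht' := hmaps ht
  have htc : ((t.toNNReal : ℝ≥0) : ℝ) = t := Real.coe_toNNReal _ (s.coe_nonneg.trans ht.1)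
  have e := h n _ ht'
  have e' := h' n _ ht'
  rw [htc] at e e'
  have hBI : IntervalIntegrable (fun u : ℝ => inner ℝ (M.B (z u.toNNReal ω)) (M.expTest n))
      volume s t := by
    refine ((hz.locallyIntegrable_controlPath ω).integrableOn_isCompact
      isCompact_uIcc).intervalIntegrable.mul_const (inner ℝ (M.B 1) (M.expTest n)) |>.congr
      fun u _ => ?_
    rw [M.B_eq_smul (z u.toNNReal ω), real_inner_smul_left, controlPath]
  have i1 : IntervalIntegrable (fun u : ℝ => inner ℝ (Y u.toNNReal ω) (M.adjointExpTest n))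
      volume s t :=
    ((c1.mono (Icc_subset_Icc_right ht.2)).inner continuousOn_const).intervalIntegrable_of_Icc ht.1
  have i2 : IntervalIntegrable (fun u : ℝ => inner ℝ (Y' u.toNNReal ω) (M.adjointExpTest n))
      volume s t :=
    ((c2.mono (Icc_subset_Icc_right ht.2)).inner continuousOn_const).intervalIntegrable_of_Icc ht.1
  change inner ℝ _ (M.expTest n) = inner ℝ _ (M.expTest n)
    + (∫ u in (s : ℝ)..t, (inner ℝ (Y u.toNNReal ω) (M.adjointExpTest n)
        + inner ℝ (M.B (z u.toNNReal ω)) (M.expTest n))) + inner ℝ _ (M.expTest n) at e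
  change inner ℝ _ (M.expTest n) = inner ℝ _ (M.expTest n)
    + (∫ u in (s : ℝ)..t, (inner ℝ (Y' u.toNNReal ω) (M.adjointExpTest n)
        + inner ℝ (M.B (z u.toNNReal ω)) (M.expTest n))) + inner ℝ _ (M.expTest n) at e'
  rw [intervalIntegral.integral_add i1 hBI] at e
  rw [intervalIntegral.integral_add i2 hBI] at e'
  simp only [inner_sub_left]
  rw [intervalIntegral.integral_sub i1 i2]
  linarith

end DelayModel

end Dynamics

/-! ### Gaussian moments -/

section Moments

/-- A bound for the `k`-th moment of `1 + |X|`, `X` a centred Gaussian of variance at most `T`. -/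
def gaussianMomentBound (T : ℝ) (k : ℕ) : ℝ :=
  k.factorial * (Real.exp 1 * (2 * Real.exp (T / 2)))

/-- From `y^k / k! ≤ e^y` at `y = 1 + |x|`. It reduces polynomial moments to the moment generating
function at `±1`. -/
theorem one_add_abs_pow_le (x : ℝ) (k : ℕ) :
    (1 + |x|) ^ k ≤ k.factorial * (Real.exp 1 * (Real.exp (1 * x) + Real.exp (-1 * x))) := by
  have h := Real.pow_div_factorial_le_exp (1 + |x|) (by positivity) k
  rw [div_le_iff₀ (by positivity), mul_comm] at h
  refine h.trans (mul_le_mul_of_nonneg_left ?_ (by positivity))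
  rw [Real.exp_add]
  refine mul_le_mul_of_nonneg_left ?_ (Real.exp_nonneg _)
  rcases abs_cases x with ⟨hx, _⟩ | ⟨hx, _⟩
  · rw [hx, one_mul]; linarith [Real.exp_nonneg (-1 * x)]
  · rw [hx, neg_one_mul]; linarith [Real.exp_nonneg (1 * x)]

theorem gaussianReal_moment {v : ℝ≥0} {T : ℝ} (hv : (v : ℝ) ≤ T) (k : ℕ) :
    Integrable (fun x : ℝ => (1 + |x|) ^ k) (gaussianReal 0 v) ∧
      ∫ x, (1 + |x|) ^ k ∂(gaussianReal 0 v) ≤ gaussianMomentBound T k := by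
  have hi : ∀ a : ℝ, Integrable (fun x => Real.exp (a * x)) (gaussianReal 0 v) :=
    fun a => integrable_exp_mul_gaussianReal a
  have hm : ∀ a : ℝ, ∫ x, Real.exp (a * x) ∂(gaussianReal 0 v) = Real.exp (v * a ^ 2 / 2) := by
    intro a
    have := congrFun (mgf_id_gaussianReal (μ := 0) (v := v)) a
    simpa [mgf] using this
  have hI := ((hi 1).add (hi (-1))).const_mul (Real.exp 1) |>.const_mul (k.factorial : ℝ)
  have hint : Integrable (fun x : ℝ => (1 + |x|) ^ k) (gaussianReal 0 v) := by
    refine hI.mono' (Continuous.aestronglyMeasurable (by fun_prop)) (ae_of_all _ fun x => ?_)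
    rw [Real.norm_of_nonneg (by positivity)]
    exact one_add_abs_pow_le x k
  refine ⟨hint, (integral_mono hint hI fun x => one_add_abs_pow_le x k).trans ?_⟩
  simp only [Pi.add_apply]
  rw [integral_const_mul, integral_const_mul, integral_add (hi 1) (hi (-1)), hm, hm,
    gaussianMomentBound]
  have : Real.exp ((v : ℝ) / 2) ≤ Real.exp (T / 2) := Real.exp_le_exp.2 (by linarith)
  have h2 : Real.exp (v * 1 ^ 2 / 2) + Real.exp (v * (-1) ^ 2 / 2) ≤ 2 * Real.exp (T / 2) := by
    norm_num
    linarith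
  gcongr

/-- Jensen's inequality for the sum of the value at the right end point and the integral. -/
theorem endpoint_add_integral_pow_le {g : ℝ → ℝ} (hg : Continuous g) (hg0 : ∀ u, 0 ≤ g u)
    {s t T : ℝ} (hst : s ≤ t) (htT : t - s ≤ T) (k : ℕ) :
    (g t + ∫ u in s..t, g u) ^ k ≤ (1 + T) ^ k * (g t ^ k + ∫ u in s..t, g u ^ k) := by
  -- End point value and integral become one integral against a measure of mass `1 + (t - s) ≥ 1`,
  -- so a single use of Jensen suffices.
  set ν : Measure ℝ := Measure.dirac t + volume.restrict (Ioc s t) with hν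
  have hint : ∀ f : ℝ → ℝ, Continuous f → Integrable f ν ∧ ∫ u, f u ∂ν = f t + ∫ u in s..t, f u := by
    intro f hf
    have h1 : Integrable f (Measure.dirac t) := integrable_dirac (by simp)
    have h2 : Integrable f (volume.restrict (Ioc s t)) :=
      (intervalIntegrable_iff_integrableOn_Ioc_of_le hst).1 (hf.intervalIntegrable _ _)
    refine ⟨h1.add_measure h2, ?_⟩
    rw [integral_add_measure h1 h2, integral_dirac, intervalIntegral.integral_of_le hst]
  have hmass : ν.real univ = 1 + (t - s) := by
    have := (hint (fun _ => 1) continuous_const).2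
    simpa using this
  have hfin : IsFiniteMeasure ν := by rw [hν]; infer_instance
  have hne : NeZero ν := ⟨fun h => by
    rw [h] at hmass
    simp at hmass
    linarith⟩
  set a := 1 + (t - s) with ha
  have ha1 : 1 ≤ a := by linarith
  have hJ := (convexOn_pow k).map_average_le (μ := ν) (f := g) (continuous_pow k).continuousOn
    isClosed_Ici (ae_of_all _ fun u => hg0 u) (hint g hg).1 (hint _ (hg.pow k)).1
  rw [average_eq, average_eq, hmass, (hint g hg).2, (hint (fun u => g u ^ k) (hg.pow k)).2, smul_eq_mul,
    smul_eq_mul, mul_pow, inv_pow] at hJ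
  set S := g t + ∫ u in s..t, g u
  have hQ : 0 ≤ g t ^ k + ∫ u in s..t, g u ^ k :=
    add_nonneg (pow_nonneg (hg0 _) _)
      (intervalIntegral.integral_nonneg hst fun u _ => pow_nonneg (hg0 u) _)
  have hak : 0 < a ^ k := by positivity
  have h1 : S ^ k ≤ a ^ k * (a⁻¹ * (g t ^ k + ∫ u in s..t, g u ^ k)) := by
    rw [inv_mul_le_iff₀ hak] at hJ
    exact hJ
  refine h1.trans ?_
  have h2 : a⁻¹ * (g t ^ k + ∫ u in s..t, g u ^ k) ≤ g t ^ k + ∫ u in s..t, g u ^ k :=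
    mul_le_of_le_one_left hQ (inv_le_one_of_one_le₀ ha1)
  have h3 : a ^ k ≤ (1 + T) ^ k := by gcongr; linarith
  exact mul_le_mul h3 h2 (mul_nonneg (by positivity) hQ)
    (hak.le.trans h3)

variable {Ω : Type*} [mΩ : MeasurableSpace Ω]

/-- Moments of `1 + |B(T) - B(s)| + ∫ₛᵀ |B(u) - B(s)| du` for a Brownian motion `B`, up to a
dominating random variable. -/
theorem exists_dominating_brownian {P : Measure Ω} [IsProbabilityMeasure P] {B : ℝ≥0 → Ω → ℝ}
    (hB : IsPreBrownianReal B P) (hBm : ∀ t, StronglyMeasurable (B t))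
    (hBc : ∀ ω, Continuous fun t => B t ω) {s T : ℝ≥0} (hsT : s ≤ T) (k : ℕ) :
    ∃ Q : Ω → ℝ, Integrable Q P ∧
      ∫ ω, Q ω ∂P ≤ (1 + T) ^ k * ((1 + T) * gaussianMomentBound T k) ∧
      ∀ ω, (1 + |B T ω - B s ω| + ∫ u in (s : ℝ)..T, |B u.toNNReal ω - B s ω|) ^ k ≤ Q ω := by
  have hsT' : (s : ℝ) ≤ T := by exact_mod_cast hsT
  set C := gaussianMomentBound T k
  have hC : 0 ≤ C := by simp only [C, gaussianMomentBound]; positivity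
  set g : Ω → ℝ → ℝ := fun ω u => 1 + |B u.toNNReal ω - B s ω| with hg
  have hgc : ∀ ω, Continuous (g ω) := fun ω =>
    continuous_const.add (((hBc ω).comp continuous_real_toNNReal).sub continuous_const).abs
  have hg0 : ∀ ω u, 0 ≤ g ω u := fun ω u => by positivity
  have hmom : ∀ u ∈ Icc (s : ℝ) T, Integrable (fun ω => g ω u ^ k) P ∧
      ∫ ω, g ω u ^ k ∂P ≤ C := by
    intro u hu
    have hu0 : 0 ≤ u := s.coe_nonneg.trans hu.1
    have hlaw := hB.hasLaw_sub u.toNNReal s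
    have hv : ((nndist (u.toNNReal : ℝ≥0).1 s.1 : ℝ≥0) : ℝ) ≤ T := by
      change dist ((u.toNNReal : ℝ≥0) : ℝ) (s : ℝ) ≤ T
      rw [Real.coe_toNNReal _ hu0, Real.dist_eq, abs_of_nonneg (by linarith [hu.1])]
      linarith [hu.2, s.coe_nonneg]
    obtain ⟨h1, h2⟩ := gaussianReal_moment hv k
    have hae : AEStronglyMeasurable (fun x : ℝ => (1 + |x|) ^ k)
        (gaussianReal 0 (nndist (u.toNNReal : ℝ≥0).1 s.1)) :=
      Continuous.aestronglyMeasurable (by fun_prop)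
    have h3 := hlaw.integral_comp hae
    refine ⟨?_, ?_⟩
    · rw [← hlaw.map_eq] at h1
      exact h1.comp_aemeasurable hlaw.aemeasurable
    · exact h3.trans_le h2
  have hjoint : StronglyMeasurable (Function.uncurry fun (u : ℝ) ω => g ω u) :=
    stronglyMeasurable_uncurry_of_continuous_of_stronglyMeasurable hgc fun u =>
      stronglyMeasurable_const.add ((hBm _).sub (hBm s)).norm
  have hprod : Integrable (fun p : Ω × ℝ => g p.1 p.2 ^ k)
      (P.prod (volume.restrict (Ioc (s : ℝ) T))) := by
    have hm : StronglyMeasurable fun p : Ω × ℝ => g p.1 p.2 ^ k :=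
      (hjoint.comp_measurable measurable_swap).pow k
    -- Tonelli: the moments are bounded by `C` uniformly over a time interval of finite length.
    rw [integrable_prod_iff' hm.aestronglyMeasurable]
    constructor
    · filter_upwards [ae_restrict_mem measurableSet_Ioc] with u hu
        using (hmom u (Ioc_subset_Icc_self hu)).1
    · refine Integrable.mono' (integrable_const C) hm.norm.integral_prod_left'.aestronglyMeasurable ?_
      filter_upwards [ae_restrict_mem measurableSet_Ioc] with u hu
      rw [Real.norm_of_nonneg (integral_nonneg fun _ => norm_nonneg _)]
      refine le_of_eq_of_le (integral_congr_ae (ae_of_all _ fun ω => ?_))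
        (hmom u (Ioc_subset_Icc_self hu)).2
      exact Real.norm_of_nonneg (pow_nonneg (hg0 ω u) k)
  have hTm := hmom T ⟨hsT', le_rfl⟩
  have hI2 := hprod.integral_prod_left
  refine ⟨fun ω => (1 + T) ^ k * (g ω T ^ k + ∫ u in (s : ℝ)..T, g ω u ^ k), ?_, ?_, ?_⟩
  · simp only [intervalIntegral.integral_of_le hsT']
    exact (hTm.1.add hI2).const_mul _
  · simp only [intervalIntegral.integral_of_le hsT']
    rw [integral_const_mul, integral_add hTm.1 hI2, integral_integral_swap hprod]
    refine mul_le_mul_of_nonneg_left ?_ (by positivity)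
    have h1 : ∫ u in Ioc (s : ℝ) T, ∫ ω, g ω u ^ k ∂P ≤ ∫ _ in Ioc (s : ℝ) T, C :=
      setIntegral_mono_on hprod.integral_prod_right (integrable_const C) measurableSet_Ioc
        fun u hu => (hmom u (Ioc_subset_Icc_self hu)).2
    rw [setIntegral_const, Real.volume_real_Ioc_of_le hsT', smul_eq_mul] at h1
    nlinarith [hTm.2, mul_nonneg s.coe_nonneg hC]
  · intro ω
    refine le_trans ?_ (endpoint_add_integral_pow_le (hgc ω) (hg0 ω) hsT'
      (by linarith [s.coe_nonneg]) k)
    have hc : Continuous fun u : ℝ => |B u.toNNReal ω - B s ω| :=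
      (((hBc ω).comp continuous_real_toNNReal).sub continuous_const).abs
    have h1 : ∫ u in (s : ℝ)..T, |B u.toNNReal ω - B s ω| ≤ ∫ u in (s : ℝ)..T, g ω u :=
      intervalIntegral.integral_mono_on hsT' (hc.intervalIntegrable _ _)
        ((hgc ω).intervalIntegrable _ _) fun u _ => by simp only [g]; linarith
    have h0 : 0 ≤ ∫ u in (s : ℝ)..T, |B u.toNNReal ω - B s ω| :=
      intervalIntegral.integral_nonneg hsT' fun _ _ => abs_nonneg _
    have h2 : g ω T = 1 + |B T ω - B s ω| := by simp only [g, Real.toNNReal_coe]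
    rw [h2]
    gcongr

end Moments

/-! ### A continuous version of the Brownian motion -/

section Completion

variable {Ω : Type*} [mΩ : MeasurableSpace Ω] {P : Measure Ω} {W : ℝ≥0 → Ω → ℝ}
  (hW : ∀ t, StronglyMeasurable (W t))

theorem stronglyMeasurable_completedFiltration (t : ℝ≥0) :
    StronglyMeasurable[completedFiltration P W hW t] (W t) := by
  refine Measurable.stronglyMeasurable ?_
  intro A hA
  exact ⟨(hW t).measurable hA, (W t) ⁻¹' A,
    (Filtration.stronglyAdapted_natural hW t).measurable hA, Filter.EventuallyEq.rfl⟩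

theorem measurableSet_completedFiltration_of_null {A : Set Ω} (hA : MeasurableSet A) (h0 : P A = 0)
    (t : ℝ≥0) : MeasurableSet[completedFiltration P W hW t] A :=
  ⟨hA, ∅, @MeasurableSet.empty _ (Filtration.natural W hW t), ae_eq_empty.2 h0⟩

/-- A Brownian motion has an indistinguishable version all of whose paths are continuous, adapted
to its completed filtration. -/
theorem exists_continuous_version (hB : IsBrownianReal W P) :
    ∃ B : ℝ≥0 → Ω → ℝ, StronglyAdapted (completedFiltration P W hW) B ∧
      (∀ ω, Continuous fun t => B t ω) ∧ (∀ᵐ ω ∂P, ∀ t, B t ω = W t ω) ∧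
      IsPreBrownianReal B P := by
  -- Paths in `N` are replaced by `0`. As a measurable null set, `N` belongs to every completed
  -- σ-algebra, so adaptedness is kept.
  obtain ⟨N, hN, hNm, hN0⟩ := exists_measurable_superset_of_null (ae_iff.1 hB.cont)
  have hae : ∀ᵐ ω ∂P, ∀ t, Nᶜ.indicator (W t) ω = W t ω := by
    filter_upwards [measure_eq_zero_iff_ae_notMem.1 hN0] with ω hω t
    exact indicator_of_mem hω _
  refine ⟨fun t => Nᶜ.indicator (W t), fun t => ?_, fun ω => ?_, hae, ?_⟩
  · exact (stronglyMeasurable_completedFiltration hW t).indicator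
      (measurableSet_completedFiltration_of_null hW hNm hN0 t).compl
  · by_cases hω : ω ∈ N
    · simp only [indicator_of_notMem (notMem_compl_iff.2 hω)]
      exact continuous_const
    · simp only [indicator_of_mem (mem_compl hω)]
      by_contra hc
      exact hω (hN hc)
  · exact hB.toIsPreBrownianReal.congr fun t => by
      filter_upwards [hae] with ω hω using (hω t).symm

end Completion

/-! ### Measurability and size of the payoff -/

section Payoff

variable {Ω : Type*} [mΩ : MeasurableSpace Ω] {M : DelayModel}

theorem DelayModel.IsWeakSolution.measurable_payoff {P : Measure Ω} {ℱ : Filtration ℝ≥0 mΩ}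
    {W : ℝ≥0 → Ω → ℝ} {T s : ℝ≥0} (hsT : s ≤ T) {x : M.X} {z : ℝ≥0 → Ω → ℝ≥0}
    (hz : M.IsAdmissible ℱ z) {Y : ℝ≥0 → Ω → M.X} (hY : M.IsWeakSolution P ℱ W T s x z Y)
    {φ₀ : ℝ → ℝ} {h₀ : ℝ≥0 → ℝ≥0} (hφ : Measurable φ₀) (hh : Measurable h₀) :
    Measurable (M.payoff φ₀ h₀ T s z Y) := by
  have h1 : StronglyMeasurable fun ω => (Y T ω).fst :=
    (WithLp.fstL 2 ℝ ℝ (HistorySpace M.r)).continuous.comp_stronglyMeasurable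
      ((hY.adapted T ⟨hsT, le_rfl⟩).mono (ℱ.le T))
  have hp : IsStronglyProgressive ℱ
      fun t : ℝ≥0 => (fun (u : ℝ) ω => (h₀ (z u.toNNReal ω) : ℝ)) t := by
    intro i
    simp only [Real.toNNReal_coe]
    exact (measurable_coe_nnreal_real.comp (hh.comp (hz.1 i).measurable)).stronglyMeasurable
  -- The running cost is a convolution with the constant kernel `-1`.
  have h2 := (stronglyMeasurable_causalConv (Z := fun u ω => (h₀ (z u.toNNReal ω) : ℝ)) hp
    (c := fun _ => (-1 : ℝ)) continuous_const s T).mono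
    (ℱ.le T)
  simp only [causalConv_of_le (show (s : ℝ) ≤ T by exact_mod_cast hsT), smul_eq_mul,
    mul_neg_one] at h2
  exact (hφ.comp h1.measurable).add h2.measurable

theorem DelayModel.abs_payoff_le {ℱ : Filtration ℝ≥0 mΩ} {T s : ℝ≥0} (hsT : s ≤ T)
    {z : ℝ≥0 → Ω → ℝ≥0} (hz : M.IsAdmissible ℱ z) (Y : ℝ≥0 → Ω → M.X) {φ₀ : ℝ → ℝ}
    {h₀ : ℝ≥0 → ℝ≥0} {m K : ℝ} (hK : 0 ≤ K) (hφ : ∀ y : ℝ, |φ₀ y| ≤ K * (1 + |y|) ^ m)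
    (hh : ∀ u ∈ M.U, |(h₀ u : ℝ)| ≤ K) (ω : Ω) :
    |M.payoff φ₀ h₀ T s z Y ω| ≤ K * (1 + |(Y T ω).fst|) ^ m + K * T := by
  refine (abs_add_le _ _).trans (add_le_add (hφ _) ?_)
  have h := intervalIntegral.norm_integral_le_of_norm_le_const (a := (s : ℝ)) (b := T) (C := K)
    (f := fun t : ℝ => -(h₀ (z t.toNNReal ω) : ℝ)) fun t _ => by
      rw [norm_neg]; exact hh _ (hz.2 _ _)
  refine h.trans (mul_le_mul_of_nonneg_left ?_ hK)
  have hsT' : (s : ℝ) ≤ T := by exact_mod_cast hsT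
  rw [abs_of_nonneg (by linarith)]
  linarith [s.coe_nonneg]

end Payoff

end

/-! ### The growth bound -/

theorem proposition3p1 (M : DelayModel) (T : ℝ≥0) (hT : 0 < T) (m K : ℝ) (hm : 0 ≤ m)
    (hK : 0 < K) :
    ∃ N : ℝ, ∀ (φ₀ : ℝ → ℝ) (h₀ : ℝ≥0 → ℝ≥0), Measurable φ₀ → Measurable h₀ →
      (∀ y : ℝ, |φ₀ y| ≤ K * (1 + |y|) ^ m) → (∀ u ∈ M.U, |(h₀ u : ℝ)| ≤ K) →
      ∀ {Ω : Type*} [MeasurableSpace Ω] (P : Measure Ω) [IsProbabilityMeasure P]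
        (W : ℝ≥0 → Ω → ℝ) (hWm : ∀ t, StronglyMeasurable (W t)), IsBrownianReal W P →
      ∀ s ≤ T, ∀ x : M.X,
        -- every admissible control has a state trajectory, with integrable payoff
        (∀ z, M.IsAdmissible (completedFiltration P W hWm) z →
          (∃ Y, M.IsWeakSolution P (completedFiltration P W hWm) W T s x z Y) ∧
          ∀ Y, M.IsWeakSolution P (completedFiltration P W hWm) W T s x z Y →
            Integrable (M.payoff φ₀ h₀ T s z Y) P) ∧
        -- the bound `|V(s,x)| ≤ N (1 + |x|)^m`
        ((-(N * (1 + ‖x‖) ^ m) : ℝ) : EReal)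
            ≤ M.value P (completedFiltration P W hWm) W φ₀ h₀ T s x ∧
        M.value P (completedFiltration P W hWm) W φ₀ h₀ T s x
            ≤ ((N * (1 + ‖x‖) ^ m : ℝ) : EReal) := by
  obtain ⟨ρ, hρ, hres⟩ := exists_volterra_resolvent M.continuous_kernel T.coe_nonneg
  obtain ⟨R, hR⟩ := isCompact_Icc.exists_bound_of_continuousOn (s := Icc 0 (T : ℝ)) hρ.continuousOn
  have hR0 : 0 ≤ R := (norm_nonneg _).trans (hR 0 ⟨le_rfl, T.coe_nonneg⟩)
  set A : ℝ := (1 + 2 * ‖oneHist M.r‖ + (M.b₀ + 2 * ‖oneHist M.r‖ * ‖M.b₁‖) * (M.uMax * T))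
    * (1 + R * T) + 1 + R with hA
  have hA0 : 0 ≤ A := by have := M.b₀_nonneg; positivity
  -- Rounding `m` up is harmless because only the noise factor, which is at least `1`, is raised to
  -- the power `k`; the exponent of `1 + ‖x‖` stays `m`.
  set k : ℕ := ⌈m⌉₊
  set C : ℝ := (1 + T) ^ k * ((1 + T) * gaussianMomentBound T k)
  set D : ℝ := K * (A * (1 + |M.σ|)) ^ m with hD
  have hD0 : 0 ≤ D := by positivity
  -- `D * C` bounds the terminal payoff, `C` being the noise moment, and `K * T` the running cost.
  refine ⟨D * C + K * T, ?_⟩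
  intro φ₀ h₀ hφm hhm hφ hh Ω _ P _ W hWm hW s hsT x
  have hsT' : (s : ℝ) ≤ T := by exact_mod_cast hsT
  obtain ⟨B, hBad, hBc, hBW, hBpre⟩ := exists_continuous_version hWm hW
  obtain ⟨Q, hQi, hQC, hQ⟩ := exists_dominating_brownian hBpre
    (fun t => (hBad t).mono ((completedFiltration P W hWm).le t)) hBc hsT k
  have hexist : ∀ z, M.IsAdmissible (completedFiltration P W hWm) z →
      M.IsWeakSolution P (completedFiltration P W hWm) W T s x z (M.stateDynamics ρ B s x z) :=
    fun z hz => DelayModel.isWeakSolution_stateDynamics hρ hres hBad hBc hBW x hz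
  have hbound : ∀ z Y, M.IsAdmissible (completedFiltration P W hWm) z →
      M.IsWeakSolution P (completedFiltration P W hWm) W T s x z Y →
      ∀ᵐ ω ∂P, ‖M.payoff φ₀ h₀ T s z Y ω‖ ≤ D * (1 + ‖x‖) ^ m * Q ω + K * T := by
    intro z Y hz hY
    -- Uniqueness of the terminal present value carries the bound from the explicit solution to
    -- every weak solution.
    filter_upwards [hY.fst_ae_eq hsT hz (hexist z hz)] with ω hω
    refine (DelayModel.abs_payoff_le hsT hz Y hK.le hφ hh ω).trans ?_
    rw [hω]
    have hw := continuous_noisePath M.σ (hBc ω) s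
    have h1 : 1 + |M.present ρ s x (noisePath M.σ B s ω) (controlPath z ω) T| ≤ _ :=
      M.one_add_abs_present_le s x T.coe_nonneg M.uMax.coe_nonneg hR hw
        (hz.locallyIntegrable_controlPath ω) (hz.abs_controlPath_le ω) hsT'
        (by linarith [s.coe_nonneg])
    rw [← hA] at h1
    set J := ∫ u in (s : ℝ)..T, |B u.toNNReal ω - B s ω| with hJ
    have hJ0 : 0 ≤ J := intervalIntegral.integral_nonneg hsT' fun _ _ => abs_nonneg _
    set S := 1 + |B T ω - B s ω| + J with hS
    have hS1 : 1 ≤ S := by linarith [abs_nonneg (B T ω - B s ω)]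
    have hwT : |noisePath M.σ B s ω T| = |M.σ| * |B T ω - B s ω| := by
      rw [noisePath, Real.toNNReal_coe, min_eq_left hsT, abs_mul]
    have hwI : ∫ u in (s : ℝ)..T, |noisePath M.σ B s ω u| = |M.σ| * J := by
      rw [hJ, ← intervalIntegral.integral_const_mul]
      refine intervalIntegral.integral_congr fun u hu => ?_
      rw [uIcc_of_le hsT'] at hu
      simp only [noisePath, abs_mul]
      rw [min_eq_left (NNReal.le_toNNReal_of_coe_le hu.1)]
    rw [hwT, hwI] at h1
    have h2 : 1 + |M.σ| * |B T ω - B s ω| + |M.σ| * J ≤ (1 + |M.σ|) * S := by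
      rw [hS]
      nlinarith [abs_nonneg M.σ, abs_nonneg (B T ω - B s ω)]
    have h3 : 1 + |(M.stateDynamics ρ B s x z T ω).fst| ≤ A * (1 + |M.σ|) * (1 + ‖x‖) * S := by
      refine h1.trans ((mul_le_mul_of_nonneg_left h2 (by positivity)).trans_eq ?_)
      ring
    have h4 : S ^ m ≤ Q ω := by
      refine le_trans ?_ (hQ ω)
      rw [← Real.rpow_natCast]
      exact Real.rpow_le_rpow_of_exponent_le hS1 (Nat.le_ceil m)
    have h5 : (1 + |(M.stateDynamics ρ B s x z T ω).fst|) ^ m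
        ≤ (A * (1 + |M.σ|)) ^ m * (1 + ‖x‖) ^ m * Q ω := by
      refine (Real.rpow_le_rpow (by positivity) h3 hm).trans ?_
      rw [Real.mul_rpow (by positivity) (by linarith), Real.mul_rpow (by positivity) (by positivity)]
      exact mul_le_mul_of_nonneg_left h4 (by positivity)
    have h6 := mul_le_mul_of_nonneg_left h5 hK.le
    rw [hD]
    linarith
  have hdom : Integrable (fun ω => D * (1 + ‖x‖) ^ m * Q ω + K * T) P :=
    (hQi.const_mul _).add (integrable_const _)
  have hx1 : 1 ≤ (1 + ‖x‖) ^ m := Real.one_le_rpow (by linarith [norm_nonneg x]) hm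
  have hexp : ∀ z Y, M.IsAdmissible (completedFiltration P W hWm) z →
      M.IsWeakSolution P (completedFiltration P W hWm) W T s x z Y →
      |∫ ω, M.payoff φ₀ h₀ T s z Y ω ∂P| ≤ (D * C + K * T) * (1 + ‖x‖) ^ m := by
    intro z Y hz hY
    refine (norm_integral_le_of_norm_le hdom (hbound z Y hz hY)).trans ?_
    rw [integral_add (hQi.const_mul _) (integrable_const _), integral_const_mul, integral_const,
      probReal_univ, one_smul]
    have h1 : D * (1 + ‖x‖) ^ m * ∫ ω, Q ω ∂P ≤ D * (1 + ‖x‖) ^ m * C :=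
      mul_le_mul_of_nonneg_left hQC (by positivity)
    have h2 : K * T ≤ K * T * (1 + ‖x‖) ^ m := le_mul_of_one_le_right (by positivity) hx1
    linarith
  refine ⟨fun z hz => ⟨⟨_, hexist z hz⟩, fun Y hY => hdom.mono'
    (hY.measurable_payoff hsT hz hφm hhm).aestronglyMeasurable (hbound z Y hz hY)⟩, ?_, ?_⟩
  -- The lower bound needs one competitor, since an empty supremum would be `⊥`; a constant control
  -- serves.
  · have hz : M.IsAdmissible (completedFiltration P W hWm) fun _ _ => M.uMin :=
      ⟨isStronglyProgressive_const _ _, fun _ _ => ⟨le_rfl, M.uMin_le_uMax⟩⟩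
    refine le_trans ?_ (le_iSup₂_of_le _ hz (le_iSup₂_of_le _ (hexist _ hz) le_rfl))
    exact EReal.coe_le_coe_iff.2 (neg_le_of_abs_le (hexp _ _ hz (hexist _ hz)))
  · refine iSup₂_le fun z hz => iSup₂_le fun Y hY => ?_
    exact EReal.coe_le_coe_iff.2 (le_of_abs_le (hexp z Y hz hY))
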